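/- Manifolds are smooth, finite-dimensional, Hausdorff, second countable and without boundary. A Lie algebroid over $M$ is a smooth vector bundle $A\to M$ with a smooth bundle map $\rho\colon A\to TM$ (the anchor) and a Lie bracket on $\Gamma(A)$ such that $[a,ga']=\rho(a)(g)\,a'+g[a,a']$ for $a,a'\in\Gamma(A)$, $g\in C^\infty(M)$. Put $\mathcal F_A:=\rho(\Gamma_c(A))\subset\mathfrak X_c(M)$, where the subscript $c$ denotes compact support. A singular foliation on $M$ is a $C^\infty(M)$-submodule of $\mathfrak X_c(M)$ that is locally finitely generated and closed under the Lie bracket. For a smooth map $f\colon B\to M$ and $\mathcal F\subset\mathfrak X_c(M)$ put $$f^{-1}(\mathcal F):=\Big\{X\in\mathfrak X_c(B): f_*X=\sum_i h_i\,(Y_i\circ f)\ \text{(a finite sum) with } h_i\in C_c^\infty(B),\ Y_i\in\mathcal F\Big\}.$$ **Proposition.** Let $f\colon B\to M$ be a smooth map and $A$ a Lie algebroid over $M$ with anchor $\rho$. Assume that $f^!A:=f^*A\times_{TM}TB=\{(a,w): a\in A_{f(x)},\ w\in T_xB,\ \rho(a)=f_*w\}$ is smooth, i.e. that the subspaces $\rho(A_{f(x)})+f_*(T_xB)$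 have the same dimension for all $x\in B$. Then the pullback Lie algebroid $f^!A$ over $B$ exists; its anchor is the second projection and its bracket is $$\Big[\Big(\sum_i h_ia_i,X\Big),\Big(\sum_j h'_ja'_j,X'\Big)\Big]=\Big(\sum_{i,j}h_ih'_j[a_i,a'_j]+\sum_jX(h'_j)a'_j-\sum_iX'(h_i)a_i,\ [X,X']\Big)$$ for $h_i,h'_j\in C^\infty(B)$, $a_i,a'_j\in\Gamma(A)$, where $a_i$ is written for $a_i\circ f$. Moreover $$\mathcal F_{f^!A}=f^{-1}(\mathcal F_A),$$ and in particular $f^{-1}(\mathcal F_A)$ is a singular foliation on $B$. -/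

import Mathlib

open scoped Manifold ContDiff Bundle

universe uB uM v w

noncomputable section

namespace LieAlg

/-- A smooth real vector bundle of finite rank over the manifold `M` of dimension `m`. -/
structure SmoothVectorBundle (m : ℕ) (M : Type uM) [TopologicalSpace M]
    [ChartedSpace (EuclideanSpace ℝ (Fin m)) M] where
  /-- the rank -/
  rank : ℕ
  /-- the fibres -/
  Fiber : M → Type v
  [topFiber : ∀ x, TopologicalSpace (Fiber x)]
  [addCommGroup : ∀ x, AddCommGroup (Fiber x)]
  [module : ∀ x, Module ℝ (Fiber x)]
  [topTotal : TopologicalSpace (Bundle.TotalSpace (EuclideanSpace ℝ (Fin rank)) Fiber)]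
  [fiberBundle : FiberBundle (EuclideanSpace ℝ (Fin rank)) Fiber]
  [vectorBundle : VectorBundle ℝ (EuclideanSpace ℝ (Fin rank)) Fiber]
  [smooth : ContMDiffVectorBundle ∞ (EuclideanSpace ℝ (Fin rank)) Fiber (𝓡 m)]

attribute [instance] SmoothVectorBundle.topFiber SmoothVectorBundle.addCommGroup
  SmoothVectorBundle.module SmoothVectorBundle.topTotal SmoothVectorBundle.fiberBundle
  SmoothVectorBundle.vectorBundle SmoothVectorBundle.smooth

/-- The total space of a smooth vector bundle. -/
abbrev SmoothVectorBundle.Total {m : ℕ} {M : Type*} [TopologicalSpace M]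
    [ChartedSpace (EuclideanSpace ℝ (Fin m)) M] (A : SmoothVectorBundle m M) :=
  Bundle.TotalSpace (EuclideanSpace ℝ (Fin A.rank)) A.Fiber

/-- The real vector space `Γ(A)` of smooth sections. -/
abbrev SmoothVectorBundle.Sections {m : ℕ} {M : Type*} [TopologicalSpace M]
    [ChartedSpace (EuclideanSpace ℝ (Fin m)) M] (A : SmoothVectorBundle m M) :=
  ContMDiffSection (𝓡 m) (EuclideanSpace ℝ (Fin A.rank)) ∞ A.Fiber

/-- The product `g • a` of a smooth section by a smooth function. -/
def SmoothVectorBundle.smulSection {m : ℕ} {M : Type*} [TopologicalSpace M]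
    [ChartedSpace (EuclideanSpace ℝ (Fin m)) M] (A : SmoothVectorBundle m M)
    (g : C^∞⟮𝓡 m, M; ℝ⟯) (a : A.Sections) : A.Sections :=
  ⟨fun x => g x • a x, g.contMDiff.smul_section a.contMDiff⟩

/-- The real vector space `𝔛(M)` of smooth vector fields on `M`. -/
abbrev VField (m : ℕ) (M : Type*) [TopologicalSpace M]
    [ChartedSpace (EuclideanSpace ℝ (Fin m)) M] [IsManifold (𝓡 m) ∞ M] :=
  ContMDiffSection (𝓡 m) (EuclideanSpace ℝ (Fin m)) ∞
    (TangentSpace (𝓡 m) : M → Type)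

/-- The support of a (set-theoretic) section of a family of vector spaces. -/
def secSupport {M : Type*} [TopologicalSpace M] {V : M → Type*} [∀ x, Zero (V x)]
    (s : ∀ x, V x) : Set M :=
  closure {x | s x ≠ 0}

/-- The derivative `v(g)` of the function `g` along the tangent vector `v` at `x`. -/
def dirDeriv {m : ℕ} {M : Type*} [TopologicalSpace M]
    [ChartedSpace (EuclideanSpace ℝ (Fin m)) M] (g : M → ℝ) (x : M)
    (v : TangentSpace (𝓡 m) x) : ℝ :=
  mfderiv (𝓡 m) 𝓘(ℝ, ℝ) g x v

/-- The Lie bracket of two smooth vector fields. -/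
def VField.bracket {m : ℕ} {M : Type*} [TopologicalSpace M]
    [ChartedSpace (EuclideanSpace ℝ (Fin m)) M] [IsManifold (𝓡 m) ∞ M]
    (X Y : VField m M) : VField m M :=
  ⟨VectorField.mlieBracket (𝓡 m) X Y, by
    have h1 : IsManifold (𝓡 m) (((⊤ : ℕ∞) : WithTop ℕ∞) + 1) M := ‹IsManifold (𝓡 m) ∞ M›
    have h2 : IsManifold (𝓡 m) (minSmoothness ℝ 2) M :=
      IsManifold.of_le (n := ∞) (by
        simpa using (WithTop.coe_le_coe.2 le_top : ((2 : ℕ∞) : WithTop ℕ∞) ≤ ((⊤ : ℕ∞) : WithTop ℕ∞)))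
    exact ContDiff.mlieBracket_vectorField (m := ⊤) (n := ⊤) X.contMDiff Y.contMDiff
      (by simp)⟩

/-- A Lie algebroid over `M`: a smooth vector bundle with a smooth bundle map `ρ` to the tangent
bundle and a Lie bracket on its smooth sections that satisfies the Leibniz rule. -/
structure LieAlgebroid (m : ℕ) (M : Type uM) [TopologicalSpace M]
    [ChartedSpace (EuclideanSpace ℝ (Fin m)) M] [IsManifold (𝓡 m) ∞ M]
    extends SmoothVectorBundle.{uM, v} m M where
  /-- the anchor `ρ` -/
  anchor : ∀ x, Fiber x →ₗ[ℝ] TangentSpace (𝓡 m) x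
  contMDiff_anchor : ContMDiff ((𝓡 m).prod 𝓘(ℝ, EuclideanSpace ℝ (Fin rank))) (𝓡 m).tangent ∞
    (fun p : toSmoothVectorBundle.Total =>
      (⟨p.proj, anchor p.proj p.snd⟩ : TangentBundle (𝓡 m) M))
  /-- the bracket, bilinear over `ℝ` -/
  bracket : toSmoothVectorBundle.Sections →ₗ[ℝ] toSmoothVectorBundle.Sections →ₗ[ℝ]
    toSmoothVectorBundle.Sections
  bracket_self : ∀ a, bracket a a = 0
  jacobi : ∀ a b c, bracket a (bracket b c) = bracket (bracket a b) c + bracket b (bracket a c)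
  leibniz : ∀ (a b : toSmoothVectorBundle.Sections) (g : C^∞⟮𝓡 m, M; ℝ⟯) (x : M),
    bracket a (toSmoothVectorBundle.smulSection g b) x =
      dirDeriv g x (anchor x (a x)) • b x + g x • bracket a b x

section

variable {m : ℕ} {M : Type*} [TopologicalSpace M] [ChartedSpace (EuclideanSpace ℝ (Fin m)) M]
  [IsManifold (𝓡 m) ∞ M]

/-- The vector field `ρ(a)` of a section `a` of a Lie algebroid. -/
def LieAlgebroid.anchorSection (A : LieAlgebroid m M) (a : A.Sections) : VField m M :=
  ⟨fun x => A.anchor x (a x), A.contMDiff_anchor.comp a.contMDiff⟩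

/-- The set of vector fields `𝓕_A = ρ(Γ_c(A))`. -/
def LieAlgebroid.foliation (A : LieAlgebroid m M) : Set (VField m M) :=
  {X | ∃ a : A.Sections, IsCompact (secSupport a) ∧ X = A.anchorSection a}

/-- Local finite generation of a set `𝓕` of compactly supported vector fields: near every point
there are an open set `U` and finitely many smooth vector fields `Y i` on `U` such that the elements
of `𝓕` with support in `U` are exactly the combinations of the `Y i` with coefficients in
`C_c^∞(U)` (extended by zero). -/
def IsLocallyFinitelyGenerated (𝓕 : Set (VField m M)) : Prop :=
  ∀ x : M, ∃ U : Set M, IsOpen U ∧ x ∈ U ∧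
    ∃ (k : ℕ) (Y : Fin k → ∀ y : M, TangentSpace (𝓡 m) y),
      (∀ i, ContMDiffOn (𝓡 m) (𝓡 m).tangent ∞
        (fun y => (⟨y, Y i y⟩ : TangentBundle (𝓡 m) M)) U) ∧
      ∀ X : VField m M, (X ∈ 𝓕 ∧ secSupport X ⊆ U) ↔
        ∃ h : Fin k → C^∞⟮𝓡 m, M; ℝ⟯,
          (∀ i, HasCompactSupport (h i) ∧ tsupport (h i) ⊆ U) ∧
          ∀ y, X y = ∑ i, h i y • Y i y

/-- A singular foliation on `M`: a `C^∞(M)`-submodule of the compactly supported vector fields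
that is locally finitely generated and involutive. -/
structure IsSingularFoliation (𝓕 : Set (VField m M)) : Prop where
  isCompact_support : ∀ X ∈ 𝓕, IsCompact (secSupport X)
  zero_mem : 0 ∈ 𝓕
  add_mem : ∀ X ∈ 𝓕, ∀ Y ∈ 𝓕, X + Y ∈ 𝓕
  smul_mem : ∀ (g : C^∞⟮𝓡 m, M; ℝ⟯), ∀ X ∈ 𝓕, ∀ Z : VField m M, (∀ x, Z x = g x • X x) → Z ∈ 𝓕
  locallyFinitelyGenerated : IsLocallyFinitelyGenerated 𝓕
  involutive : ∀ X ∈ 𝓕, ∀ Y ∈ 𝓕, VField.bracket X Y ∈ 𝓕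

variable {b : ℕ} {B : Type*} [TopologicalSpace B] [ChartedSpace (EuclideanSpace ℝ (Fin b)) B]
  [IsManifold (𝓡 b) ∞ B]

/-- The pullback `f⁻¹(𝓕)`: the compactly supported vector fields `X` on `B` such that
`f_* X = ∑ i, h i • (Y i ∘ f)`, a finite sum with `h i ∈ C_c^∞(B)` and `Y i ∈ 𝓕`. -/
def pullbackFoliation (f : B → M) (𝓕 : Set (VField m M)) : Set (VField b B) :=
  {X | IsCompact (secSupport X) ∧
    ∃ (k : ℕ) (h : Fin k → C^∞⟮𝓡 b, B; ℝ⟯) (Y : Fin k → VField m M),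
      (∀ i, HasCompactSupport (h i)) ∧ (∀ i, Y i ∈ 𝓕) ∧
      ∀ x, mfderiv (𝓡 b) (𝓡 m) f x (X x) = ∑ i, h i x • Y i (f x)}

/-- `f^!A` is smooth: the subspaces `ρ(A_{f(x)}) + f_*(T_x B)` have the same dimension for all
`x` in `B`. -/
def PullbackIsSmooth (f : B → M) (A : LieAlgebroid m M) : Prop :=
  ∃ r : ℕ, ∀ x : B, Module.finrank ℝ
    ↥(LinearMap.range (A.anchor (f x)) ⊔
      LinearMap.range (mfderiv (𝓡 b) (𝓡 m) f x).toLinearMap) = r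

/-- The fibre over `x` of `f^!A = f^*A ×_{TM} TB`: the pairs `(a, w)` in `A_{f(x)} × T_x B` with
`ρ(a) = f_* w`. -/
def pullbackFiber (f : B → M) (A : LieAlgebroid m M) (x : B) :
    Set (A.Fiber (f x) × TangentSpace (𝓡 b) x) :=
  {p | A.anchor (f x) p.1 = mfderiv (𝓡 b) (𝓡 m) f x p.2}

/-- An identification of the Lie algebroid `P` over `B` with the pullback Lie algebroid `f^!A`.
The map `proj` is the first projection `f^!A → A`; it covers `f` and is smooth. The
second projection `f^!A → TB` is the anchor of `P`, and the two together identify the fibres of `P`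
with those of `f^!A`. If two sections have first components `∑ i, h i • (a i ∘ f)` and
`∑ j, h' j • (a' j ∘ f)` and second components `X` and `X'`, then the first component of their
bracket is
`∑ i j, h i h' j • [a i, a' j] + ∑ j, X (h' j) • a' j - ∑ i, X' (h i) • a i`,
and the second component is `[X, X']`. -/
structure PullbackIdentification (f : B → M) (A : LieAlgebroid m M) (P : LieAlgebroid b B) where
  /-- the first projection -/
  proj : ∀ x, P.Fiber x →ₗ[ℝ] A.Fiber (f x)
  contMDiff_proj : ContMDiff ((𝓡 b).prod 𝓘(ℝ, EuclideanSpace ℝ (Fin P.rank)))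
    ((𝓡 m).prod 𝓘(ℝ, EuclideanSpace ℝ (Fin A.rank))) ∞
    (fun p : P.Total => (⟨f p.proj, proj p.proj p.snd⟩ : A.Total))
  bijOn : ∀ x, Set.BijOn (fun v => (proj x v, P.anchor x v)) Set.univ (pullbackFiber f A x)
  anchor_bracket : ∀ α β : P.Sections, P.anchorSection (P.bracket α β) =
    VField.bracket (P.anchorSection α) (P.anchorSection β)
  proj_bracket : ∀ (α β : P.Sections) (k l : ℕ)
    (h : Fin k → C^∞⟮𝓡 b, B; ℝ⟯) (a : Fin k → A.Sections)
    (h' : Fin l → C^∞⟮𝓡 b, B; ℝ⟯) (a' : Fin l → A.Sections),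
    (∀ x, proj x (α x) = ∑ i, h i x • a i (f x)) →
    (∀ x, proj x (β x) = ∑ j, h' j x • a' j (f x)) →
    ∀ x, proj x (P.bracket α β x) =
      (∑ i, ∑ j, (h i x * h' j x) • A.bracket (a i) (a' j) (f x))
      + (∑ j, dirDeriv (h' j) x (P.anchor x (α x)) • a' j (f x))
      - ∑ i, dirDeriv (h i) x (P.anchor x (β x)) • a i (f x)

/-- `P` is (up to identification) the pullback Lie algebroid `f^!A`. -/
def IsPullback (f : B → M) (A : LieAlgebroid m M) (P : LieAlgebroid b B) : Prop :=
  Nonempty (PullbackIdentification f A P)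

end

end LieAlg

end

noncomputable section

namespace LieAlg

open Set Filter Topology Bundle

/-! ### Smooth sections of a vector bundle along a map -/

section Along

variable {m : ℕ} {M : Type*} [TopologicalSpace M] [ChartedSpace (EuclideanSpace ℝ (Fin m)) M]
  {EN : Type*} [NormedAddCommGroup EN] [NormedSpace ℝ EN] {HN : Type*} [TopologicalSpace HN]
  {J : ModelWithCorners ℝ EN HN} {N : Type*} [TopologicalSpace N] [ChartedSpace HN N]
  {F : Type*} [NormedAddCommGroup F] [NormedSpace ℝ F] {V : M → Type*}
  [TopologicalSpace (TotalSpace F V)] [∀ x, TopologicalSpace (V x)] [∀ x, AddCommGroup (V x)]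
  [∀ x, Module ℝ (V x)] [FiberBundle F V] [VectorBundle ℝ F V]
  {g : N → M} {s : Set N} {x₀ : N}

/-! Let T be the bundle map f^*A ⊕ TB → f^*TM, (a, w) ↦ ρ(a) − f_*w, whose fibrewise kernel is f^!A.
By rank–nullity the hypothesis says that ker T has constant dimension, and such kernels form a
smooth bundle: if linear coordinates q on the model restrict to an isomorphism on ker T_{x₀}, then
(q, T_x) is injective for x near x₀, and a smooth left inverse recovers a vector of ker T_x from its
q-coordinates (`exists_kernel_chart`, `exists_pullbackBundle`).

A section of f^*A is locally a combination ∑ h_i (a_i ∘ f), but in many ways, so the bracket formula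
must be shown to be independent of choices. The computation is done on formal combinations, in
C^∞(B) ⊗_ℝ Γ(A). There the formula is the bracket of a semidirect product with 𝔛(B), so
antisymmetry, Jacobi and Leibniz hold formally (`pairBracket_jacobi`). The fibre product condition
ρ(ξ) = f_*X enters twice. First, the value of the bracket depends only on the germs of the sections
represented: when a function c on M is moved from the section to the coefficient, the Leibniz rule
of A contributes ρ(η)(c), the derivative of the coefficient contributes Y(c ∘ f), and these agree
(`exists_frame_presentation`, `formalEval_pairBracket_congr`). Second, the bracket stays in f^!A;
tested on functions, this follows from ρ preserving brackets, itself a consequence of Jacobi and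
Leibniz (`LieAlgebroid.deriv_bracket`, `anchor_pairBracket`).

For the foliations only the bundle matters. By a partition of unity, a compactly supported section
of f^*A is a finite sum ∑ h_i (a_i ∘ f) with compactly supported h_i and a_i
(`SmoothVectorBundle.SmoothAlong.exists_eq_sum`); applying ρ puts f_*X into the required form.
Conversely, f_*X = ∑ h_i ρ(a_i) ∘ f says that (∑ h_i a_i ∘ f, X) is a section of f^!A. Finally,
ρ(Γ_c) of any Lie algebroid is a singular foliation, generated locally by the images of a frame. -/

theorem contMDiffWithinAt_add_along {σ τ : ∀ x, V (g x)}
    (hσ : ContMDiffWithinAt J ((𝓡 m).prod 𝓘(ℝ, F)) ∞ (fun x => (⟨g x, σ x⟩ : TotalSpace F V)) s x₀)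
    (hτ : ContMDiffWithinAt J ((𝓡 m).prod 𝓘(ℝ, F)) ∞
      (fun x => (⟨g x, τ x⟩ : TotalSpace F V)) s x₀) :
    ContMDiffWithinAt J ((𝓡 m).prod 𝓘(ℝ, F)) ∞
      (fun x => (⟨g x, σ x + τ x⟩ : TotalSpace F V)) s x₀ := by
  rw [contMDiffWithinAt_totalSpace] at *
  refine ⟨hσ.1, ?_⟩
  set e := trivializationAt F V (g x₀)
  have h0 : g x₀ ∈ e.baseSet := FiberBundle.mem_baseSet_trivializationAt' (g x₀)
  have hmem : ∀ᶠ x in 𝓝[s] x₀, g x ∈ e.baseSet :=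
    hσ.1.continuousWithinAt (e.open_baseSet.mem_nhds h0)
  -- The trivialization is linear on fibres over its base set, and g stays in that set near x₀.
  refine ContMDiffWithinAt.congr_of_eventuallyEq (hσ.2.add hτ.2) ?_
    ((e.linear ℝ h0).map_add _ _)
  filter_upwards [hmem] with x hx
  exact (e.linear ℝ hx).map_add _ _

theorem contMDiffWithinAt_smul_along {h : N → ℝ} {σ : ∀ x, V (g x)}
    (hh : ContMDiffWithinAt J 𝓘(ℝ, ℝ) ∞ h s x₀)
    (hσ : ContMDiffWithinAt J ((𝓡 m).prod 𝓘(ℝ, F)) ∞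
      (fun x => (⟨g x, σ x⟩ : TotalSpace F V)) s x₀) :
    ContMDiffWithinAt J ((𝓡 m).prod 𝓘(ℝ, F)) ∞
      (fun x => (⟨g x, h x • σ x⟩ : TotalSpace F V)) s x₀ := by
  rw [contMDiffWithinAt_totalSpace] at *
  refine ⟨hσ.1, ?_⟩
  set e := trivializationAt F V (g x₀)
  have h0 : g x₀ ∈ e.baseSet := FiberBundle.mem_baseSet_trivializationAt' (g x₀)
  have hmem : ∀ᶠ x in 𝓝[s] x₀, g x ∈ e.baseSet :=
    hσ.1.continuousWithinAt (e.open_baseSet.mem_nhds h0)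
  refine ContMDiffWithinAt.congr_of_eventuallyEq (hh.smul hσ.2) ?_
    ((e.linear ℝ h0).map_smul _ _)
  filter_upwards [hmem] with x hx
  exact (e.linear ℝ hx).map_smul _ _

theorem contMDiffWithinAt_zero_along (hg : ContMDiffWithinAt J (𝓡 m) ∞ g s x₀) :
    ContMDiffWithinAt J ((𝓡 m).prod 𝓘(ℝ, F)) ∞
      (fun x => (⟨g x, 0⟩ : TotalSpace F V)) s x₀ :=
  (contMDiff_zeroSection ℝ V (F := F) (g x₀)).comp_contMDiffWithinAt x₀ hg

theorem contMDiffWithinAt_sum_along {ι : Type*} (t : Finset ι) {σ : ι → ∀ x, V (g x)}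
    (hg : ContMDiffWithinAt J (𝓡 m) ∞ g s x₀)
    (hσ : ∀ i ∈ t, ContMDiffWithinAt J ((𝓡 m).prod 𝓘(ℝ, F)) ∞
      (fun x => (⟨g x, σ i x⟩ : TotalSpace F V)) s x₀) :
    ContMDiffWithinAt J ((𝓡 m).prod 𝓘(ℝ, F)) ∞
      (fun x => (⟨g x, ∑ i ∈ t, σ i x⟩ : TotalSpace F V)) s x₀ := by
  classical
  induction t using Finset.induction_on with
  | empty => simpa using contMDiffWithinAt_zero_along hg
  | insert i t hi ih =>
    simp only [Finset.sum_insert hi]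
    exact contMDiffWithinAt_add_along (hσ i (by simp)) (ih fun j hj => hσ j (by simp [hj]))

variable [ContMDiffVectorBundle ∞ F V (𝓡 m)]

/-- A section along `g` with smooth coordinates in a trivialization is smooth. -/
theorem contMDiffOn_symm_along (e : Trivialization F (π F V)) [MemTrivializationAtlas e]
    {c : N → F} (hg : ContMDiffOn J (𝓡 m) ∞ g s) (hs : MapsTo g s e.baseSet)
    (hc : ContMDiffOn J 𝓘(ℝ, F) ∞ c s) :
    ContMDiffOn J ((𝓡 m).prod 𝓘(ℝ, F)) ∞
      (fun x => (⟨g x, e.symm (g x) (c x)⟩ : TotalSpace F V)) s := by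
  rw [e.contMDiffOn_iff]
  · refine ⟨hg, hc.congr fun x hx => ?_⟩
    rw [e.apply_mk_symm (hs hx)]
  · intro x hx
    exact e.mem_source.2 (hs hx)

theorem contMDiffOn_coord_along (e : Trivialization F (π F V)) [MemTrivializationAtlas e]
    {σ : ∀ x, V (g x)} (hs : MapsTo g s e.baseSet)
    (hσ : ContMDiffOn J ((𝓡 m).prod 𝓘(ℝ, F)) ∞ (fun x => (⟨g x, σ x⟩ : TotalSpace F V)) s) :
    ContMDiffOn J 𝓘(ℝ, F) ∞ (fun x => (e ⟨g x, σ x⟩).2) s :=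
  ((e.contMDiffOn_iff fun _ hx => e.mem_source.2 (hs hx)).1 hσ).2

end Along

/-! ### Smooth families of linear maps -/

section CLM

variable {EN : Type*} [NormedAddCommGroup EN] [NormedSpace ℝ EN] {HN : Type*} [TopologicalSpace HN]
  {J : ModelWithCorners ℝ EN HN} {N : Type*} [TopologicalSpace N] [ChartedSpace HN N]
  {V : Type*} [NormedAddCommGroup V] [NormedSpace ℝ V] [FiniteDimensional ℝ V]
  {W : Type*} [NormedAddCommGroup W] [NormedSpace ℝ W]

/-- A family of linear maps on a finite-dimensional space is smooth if it is pointwise smooth. -/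
theorem contMDiffOn_clm_of_apply {T : N → V →L[ℝ] W} {s : Set N}
    (h : ∀ v, ContMDiffOn J 𝓘(ℝ, W) ∞ (fun x => T x v) s) :
    ContMDiffOn J 𝓘(ℝ, V →L[ℝ] W) ∞ T s := by
  set b := Module.finBasis ℝ V
  -- Expansion over a basis: T x is the sum of the rank-one maps v ↦ bᵢ*(v) T x (bᵢ).
  have key : T = fun x => ∑ i, ContinuousLinearMap.smulRightL ℝ V W
      (LinearMap.toContinuousLinearMap (b.coord i)) (T x (b i)) := by
    funext x
    ext v
    conv_lhs => rw [← b.sum_repr v, map_sum]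
    simp [sum_apply]
  rw [key]
  refine contMDiffOn_finsetSum fun i _ => ?_
  exact (ContinuousLinearMap.contMDiff _).comp_contMDiffOn (h (b i))

-- Inversion is smooth at the units of the Banach algebra of endomorphisms. `Ring.inverse` is zero
-- off the units, which `hi` excludes.
omit [FiniteDimensional ℝ V] in
theorem contMDiffOn_inverse [CompleteSpace V] {T : N → V →L[ℝ] V} {s : Set N}
    (hT : ContMDiffOn J 𝓘(ℝ, V →L[ℝ] V) ∞ T s) (hi : ∀ x ∈ s, IsUnit (T x)) :
    ContMDiffOn J 𝓘(ℝ, V →L[ℝ] V) ∞ (fun x => Ring.inverse (T x)) s := by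
  intro x hx
  obtain ⟨u, hu⟩ := hi x hx
  have := (contDiffAt_ringInverse ℝ (n := ∞) u)
  rw [hu] at this
  exact this.contMDiffAt.comp_contMDiffWithinAt x (hT x hx)

end CLM

/-! ### Bump functions and local frames -/

section Cutoff

variable {m : ℕ} {M : Type*} [TopologicalSpace M] [T2Space M]
  [ChartedSpace (EuclideanSpace ℝ (Fin m)) M] [IsManifold (𝓡 m) ∞ M]

theorem exists_bump {U : Set M} (hU : IsOpen U) {x : M} (hx : x ∈ U) :
    ∃ χ : C^∞⟮𝓡 m, M; ℝ⟯, HasCompactSupport χ ∧ tsupport χ ⊆ U ∧ ∀ᶠ y in 𝓝 x, χ y = 1 := by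
  obtain ⟨φ, -, hφ⟩ := (SmoothBumpFunction.nhds_basis_tsupport (I := 𝓡 m) x).mem_iff.1
    (hU.mem_nhds hx)
  exact ⟨⟨φ, φ.contMDiff⟩, φ.hasCompactSupport, hφ, φ.eventuallyEq_one⟩

/-- The germ of a smooth function extends to a global function with compact support. -/
theorem exists_global_eq {U : Set M} (hU : IsOpen U) {x : M} (hx : x ∈ U) {h : M → ℝ}
    (hh : ContMDiffOn (𝓡 m) 𝓘(ℝ, ℝ) ∞ h U) :
    ∃ k : C^∞⟮𝓡 m, M; ℝ⟯, HasCompactSupport k ∧ tsupport k ⊆ U ∧ ∀ᶠ y in 𝓝 x, k y = h y := by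
  obtain ⟨χ, hc, hs, h1⟩ := exists_bump (m := m) hU hx
  have hsm : ContMDiff (𝓡 m) 𝓘(ℝ, ℝ) ∞ (fun y => χ y * h y) := by
    refine contMDiff_of_tsupport fun y hy => ?_
    have hy' : y ∈ tsupport χ := (tsupport_mul_subset_left (f := χ) (g := h)) hy
    exact χ.contMDiff.contMDiffAt.mul (hh.contMDiffAt (hU.mem_nhds (hs hy')))
  refine ⟨⟨_, hsm⟩, hc.mul_right, (tsupport_mul_subset_left (f := χ) (g := h)).trans hs, ?_⟩
  filter_upwards [h1] with y hy
  simp [hy]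

/-- A section which is smooth on an open set, multiplied by a function supported there. -/
def SmoothVectorBundle.cutoff (A : SmoothVectorBundle m M) (χ : C^∞⟮𝓡 m, M; ℝ⟯) {U : Set M}
    (hU : IsOpen U) (hs : tsupport χ ⊆ U) (σ : ∀ x, A.Fiber x)
    (hσ : ContMDiffOn (𝓡 m) ((𝓡 m).prod 𝓘(ℝ, EuclideanSpace ℝ (Fin A.rank))) ∞
      (fun x => (⟨x, σ x⟩ : A.Total)) U) : A.Sections :=
  ⟨fun x => χ x • σ x, ContMDiffOn.smul_section_of_tsupport χ.contMDiff.contMDiffOn hU hs hσ⟩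

/-- The local frame of `A` given by the preferred trivialization at `y₀`. -/
def SmoothVectorBundle.frame (A : SmoothVectorBundle m M) (y₀ : M) (i : Fin A.rank) (y : M) :
    A.Fiber y :=
  (trivializationAt (EuclideanSpace ℝ (Fin A.rank)) A.Fiber y₀).symm y
    (EuclideanSpace.single i 1)

/-- The domain of the local frame of `A` at `y₀`. -/
abbrev SmoothVectorBundle.chartSet (A : SmoothVectorBundle m M) (y₀ : M) : Set M :=
  (trivializationAt (EuclideanSpace ℝ (Fin A.rank)) A.Fiber y₀).baseSet

/-- The coefficients with respect to the local frame of `A` at `y₀`. -/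
def SmoothVectorBundle.coef (A : SmoothVectorBundle m M) (y₀ : M) (i : Fin A.rank) {y : M}
    (v : A.Fiber y) : ℝ :=
  (trivializationAt (EuclideanSpace ℝ (Fin A.rank)) A.Fiber y₀ ⟨y, v⟩).2 i

variable (A : SmoothVectorBundle m M)

omit [T2Space M] [IsManifold (𝓡 m) ∞ M] in
theorem SmoothVectorBundle.mem_chartSet (y₀ : M) : y₀ ∈ A.chartSet y₀ :=
  FiberBundle.mem_baseSet_trivializationAt' y₀

omit [T2Space M] [IsManifold (𝓡 m) ∞ M] in
theorem SmoothVectorBundle.contMDiffOn_frame (y₀ : M) (i : Fin A.rank) :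
    ContMDiffOn (𝓡 m) ((𝓡 m).prod 𝓘(ℝ, EuclideanSpace ℝ (Fin A.rank))) ∞
      (fun y => (⟨y, A.frame y₀ i y⟩ : A.Total)) (A.chartSet y₀) :=
  contMDiffOn_symm_along _ contMDiffOn_id (fun _ h => h) contMDiffOn_const

omit [T2Space M] [IsManifold (𝓡 m) ∞ M] in
theorem SmoothVectorBundle.sum_coef_frame (y₀ : M) {y : M} (hy : y ∈ A.chartSet y₀)
    (v : A.Fiber y) : ∑ i, A.coef y₀ i v • A.frame y₀ i y = v := by
  set e := trivializationAt (EuclideanSpace ℝ (Fin A.rank)) A.Fiber y₀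
  have h1 : ∀ i, A.frame y₀ i y = e.symmL ℝ y (EuclideanSpace.single i 1) :=
    fun i => (e.symmL_apply hy _).symm
  simp only [h1, ← map_smul, ← map_sum]
  have h2 : ∑ i, A.coef y₀ i v • EuclideanSpace.single i (1 : ℝ) = (e ⟨y, v⟩).2 := by
    ext j
    simp [SmoothVectorBundle.coef, e, Pi.single_apply]
  rw [h2]
  exact (e.symmL_apply hy _).trans (e.symm_apply_apply_mk hy v)

omit [T2Space M] [IsManifold (𝓡 m) ∞ M] in
theorem SmoothVectorBundle.eq_zero_of_sum_frame (y₀ : M) {y : M} (hy : y ∈ A.chartSet y₀)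
    {c : Fin A.rank → ℝ} (hc : ∑ i, c i • A.frame y₀ i y = 0) (i : Fin A.rank) : c i = 0 := by
  set e := trivializationAt (EuclideanSpace ℝ (Fin A.rank)) A.Fiber y₀
  have h1 : ∀ i, A.frame y₀ i y = e.symmL ℝ y (EuclideanSpace.single i 1) :=
    fun i => (e.symmL_apply hy _).symm
  simp only [h1, ← map_smul, ← map_sum] at hc
  have h2 : ∑ i, c i • EuclideanSpace.single i (1 : ℝ) = 0 := by
    rw [← e.continuousLinearMapAt_symmL (R := ℝ) hy (∑ i, c i • EuclideanSpace.single i (1 : ℝ)),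
      hc, map_zero]
  have := congrArg (fun v => v i) h2
  simpa [Pi.single_apply] using this

/-- Near `y₀` the local frame consists of global sections with compact support. -/
theorem SmoothVectorBundle.exists_global_frame (y₀ : M) :
    ∃ e : Fin A.rank → A.Sections, (∀ i, IsCompact (secSupport (e i))) ∧
      ∀ᶠ y in 𝓝 y₀, y ∈ A.chartSet y₀ ∧ ∀ i, e i y = A.frame y₀ i y := by
  have hU : IsOpen (A.chartSet y₀) := (trivializationAt _ A.Fiber y₀).open_baseSet
  obtain ⟨χ, hc, hs, h1⟩ := exists_bump (m := m) hU (A.mem_chartSet y₀)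
  refine ⟨fun i => A.cutoff χ hU hs (A.frame y₀ i) (A.contMDiffOn_frame y₀ i), fun i => ?_, ?_⟩
  · refine hc.of_isClosed_subset isClosed_closure (closure_mono fun y hy => ?_)
    intro h0
    exact hy (by simp [SmoothVectorBundle.cutoff, h0])
  · filter_upwards [h1, hU.mem_nhds (A.mem_chartSet y₀)] with y hy hy'
    exact ⟨hy', fun i => by simp [SmoothVectorBundle.cutoff, hy]⟩

end Cutoff

/-! ### Local coefficients of sections along a map -/

section Coefficients

variable {m : ℕ} {M : Type*} [TopologicalSpace M] [ChartedSpace (EuclideanSpace ℝ (Fin m)) M]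
  {b : ℕ} {B : Type*} [TopologicalSpace B] [T2Space B]
  [ChartedSpace (EuclideanSpace ℝ (Fin b)) B] [IsManifold (𝓡 b) ∞ B]

/-- The section `σ` along `f` of the bundle `A` is smooth. -/
def SmoothVectorBundle.SmoothAlong (A : SmoothVectorBundle m M) (f : B → M)
    (σ : ∀ x, A.Fiber (f x)) : Prop :=
  ContMDiff (𝓡 b) ((𝓡 m).prod 𝓘(ℝ, EuclideanSpace ℝ (Fin A.rank))) ∞
    (fun x => (⟨f x, σ x⟩ : A.Total))

/-- The coefficients are the coordinates of σ in the trivialization at f x₀, cut off around x₀ so as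
to be defined on all of B; the price is that the expansion holds only near x₀. -/
theorem SmoothVectorBundle.SmoothAlong.exists_coef {A : SmoothVectorBundle m M} {f : B → M}
    (hf : Continuous f) {σ : ∀ x, A.Fiber (f x)} (hσ : A.SmoothAlong (b := b) f σ) (x₀ : B) :
    ∃ h : Fin A.rank → C^∞⟮𝓡 b, B; ℝ⟯, (∀ i, HasCompactSupport (h i)) ∧
      ∀ᶠ x in 𝓝 x₀, σ x = ∑ i, h i x • A.frame (f x₀) i (f x) := by
  have hU : IsOpen (f ⁻¹' A.chartSet (f x₀)) :=
    (trivializationAt _ A.Fiber (f x₀)).open_baseSet.preimage hf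
  have hx : x₀ ∈ f ⁻¹' A.chartSet (f x₀) := A.mem_chartSet (f x₀)
  have hsm := contMDiffOn_coord_along (trivializationAt _ A.Fiber (f x₀))
    (fun x (hx : x ∈ f ⁻¹' A.chartSet (f x₀)) => hx) hσ.contMDiffOn
  have hi : ∀ i, ∃ k : C^∞⟮𝓡 b, B; ℝ⟯, HasCompactSupport k ∧
      tsupport k ⊆ f ⁻¹' A.chartSet (f x₀) ∧
      ∀ᶠ y in 𝓝 x₀, k y = A.coef (f x₀) i (σ y) := fun i =>
    exists_global_eq hU hx
      ((EuclideanSpace.proj (𝕜 := ℝ) i).contMDiff.comp_contMDiffOn hsm)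
  choose h h1 h2 h3 using hi
  refine ⟨h, h1, ?_⟩
  filter_upwards [eventually_all.2 h3, hU.mem_nhds hx] with x h4 h5
  simp only [h4]
  exact (A.sum_coef_frame (f x₀) h5 (σ x)).symm

end Coefficients

/-! ### Smooth vector bundles from linear charts -/

section Charts

/-- Linear charts for a family of vector spaces, with smooth changes of coordinates. -/
structure BundleCharts (b : ℕ) {B : Type uB} [TopologicalSpace B]
    [ChartedSpace (EuclideanSpace ℝ (Fin b)) B] (p : ℕ) (E : B → Type v) [∀ x, AddCommGroup (E x)]
    [∀ x, Module ℝ (E x)] where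
  /-- the domain of the chart centred at a point -/
  baseSet : B → Set B
  isOpen_baseSet : ∀ x, IsOpen (baseSet x)
  mem_baseSet : ∀ x, x ∈ baseSet x
  /-- the chart centred at a point, only relevant on its domain -/
  chart : ∀ _ x : B, E x ≃ₗ[ℝ] EuclideanSpace ℝ (Fin p)
  exists_change : ∀ x₀ x₁, ∃ g : B → EuclideanSpace ℝ (Fin p) →L[ℝ] EuclideanSpace ℝ (Fin p),
    ContMDiffOn (𝓡 b) 𝓘(ℝ, EuclideanSpace ℝ (Fin p) →L[ℝ] EuclideanSpace ℝ (Fin p)) ∞ g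
      (baseSet x₀ ∩ baseSet x₁) ∧
    ∀ x ∈ baseSet x₀ ∩ baseSet x₁, ∀ c, g x c = chart x₁ x ((chart x₀ x).symm c)

namespace BundleCharts

variable {b : ℕ} {B : Type uB} [TopologicalSpace B] [ChartedSpace (EuclideanSpace ℝ (Fin b)) B]
  {p : ℕ} {E : B → Type v} [∀ x, AddCommGroup (E x)] [∀ x, Module ℝ (E x)]
  (C : BundleCharts b p E)

/-- The topology of the fibres. -/
@[reducible]
def topFiber (x : B) : TopologicalSpace (E x) :=
  TopologicalSpace.induced (C.chart x x) inferInstance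

/-- The pretrivialization given by a chart. -/
def pretriv (x₀ : B) : Pretrivialization (EuclideanSpace ℝ (Fin p))
    (π (EuclideanSpace ℝ (Fin p)) E) where
  toFun q := (q.proj, C.chart x₀ q.proj q.snd)
  invFun q := ⟨q.1, (C.chart x₀ q.1).symm q.2⟩
  source := π (EuclideanSpace ℝ (Fin p)) E ⁻¹' C.baseSet x₀
  target := C.baseSet x₀ ×ˢ univ
  map_source' q hq := ⟨hq, mem_univ _⟩
  map_target' q hq := hq.1
  left_inv' q _ := by simp
  right_inv' q _ := by simp
  open_target := (C.isOpen_baseSet x₀).prod isOpen_univ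
  baseSet := C.baseSet x₀
  open_baseSet := C.isOpen_baseSet x₀
  source_eq := rfl
  target_eq := rfl
  proj_toFun _ _ := rfl

theorem pretriv_symm (x₀ : B) {x : B} (hx : x ∈ C.baseSet x₀) (c : EuclideanSpace ℝ (Fin p)) :
    (C.pretriv x₀).symm x c = (C.chart x₀ x).symm c := by
  have h := (C.pretriv x₀).mk_symm (b := x) hx c
  exact (TotalSpace.mk_inj.1 h)

/-- The prebundle given by linear charts. -/
def prebundle : @VectorPrebundle ℝ B (EuclideanSpace ℝ (Fin p)) E _ _ _ _ _ _ C.topFiber :=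
  letI := C.topFiber
  { pretrivializationAtlas := range C.pretriv
    pretrivialization_linear' := by
      rintro _ ⟨x₀, rfl⟩
      exact ⟨fun x _ => (C.chart x₀ x).toLinearMap.isLinear⟩
    pretrivializationAt := C.pretriv
    mem_base_pretrivializationAt := C.mem_baseSet
    pretrivialization_mem_atlas := fun x => mem_range_self x
    exists_coordChange := by
      rintro _ ⟨x₀, rfl⟩ _ ⟨x₁, rfl⟩
      obtain ⟨g, hg, hc⟩ := C.exists_change x₀ x₁
      refine ⟨g, hg.continuousOn, fun x hx c => ?_⟩
      rw [hc x hx, C.pretriv_symm x₀ hx.1]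
      rfl
    -- The fibre topology is induced by the chart centred at the same point, so this holds by
    -- construction.
    totalSpaceMk_isInducing := fun x => by
      change IsInducing fun w : E x => (x, C.chart x x w)
      exact isInducing_const_prod.2 ⟨rfl⟩ }

/-- The smooth vector bundle given by linear charts. -/
def toBundle : SmoothVectorBundle.{uB, v} b B :=
  letI := C.topFiber
  letI := C.prebundle.totalSpaceTopology
  letI := C.prebundle.toFiberBundle
  letI := C.prebundle.toVectorBundle
  haveI : C.prebundle.IsContMDiff (𝓡 b) ∞ := ⟨by
      rintro _ ⟨x₀, rfl⟩ _ ⟨x₁, rfl⟩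
      obtain ⟨g, hg, hc⟩ := C.exists_change x₀ x₁
      refine ⟨g, hg, fun x hx c => ?_⟩
      rw [hc x hx, C.pretriv_symm x₀ hx.1]
      rfl⟩
  { rank := p
    Fiber := E
    smooth := C.prebundle.contMDiffVectorBundle (𝓡 b) (n := ∞) }

theorem toBundle_symm (x₀ : B) {x : B} (hx : x ∈ C.baseSet x₀) (c : EuclideanSpace ℝ (Fin p)) :
    (trivializationAt (EuclideanSpace ℝ (Fin C.toBundle.rank)) C.toBundle.Fiber x₀).symm x c =
      (C.chart x₀ x).symm c :=
  C.pretriv_symm x₀ hx c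

end BundleCharts

end Charts

/-! ### Smoothness of fibrewise linear maps -/

section BundleMap

variable {b : ℕ} {B : Type*} [TopologicalSpace B] [ChartedSpace (EuclideanSpace ℝ (Fin b)) B]
  (Q : SmoothVectorBundle b B)
  {m : ℕ} {M : Type*} [TopologicalSpace M] [ChartedSpace (EuclideanSpace ℝ (Fin m)) M]
  {F : Type*} [NormedAddCommGroup F] [NormedSpace ℝ F] {V : M → Type*}
  [TopologicalSpace (TotalSpace F V)] [∀ x, TopologicalSpace (V x)] [∀ x, AddCommGroup (V x)]
  [∀ x, Module ℝ (V x)] [FiberBundle F V] [VectorBundle ℝ F V]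

/-- A fibrewise linear map is smooth if it maps local frames to smooth sections. -/
theorem SmoothVectorBundle.contMDiff_of_frame {f : B → M} (hf : ContMDiff (𝓡 b) (𝓡 m) ∞ f)
    (ψ : ∀ x, Q.Fiber x →ₗ[ℝ] V (f x))
    (hψ : ∀ x₀ i, ContMDiffWithinAt (𝓡 b) ((𝓡 m).prod 𝓘(ℝ, F)) ∞
      (fun x => (⟨f x, ψ x (Q.frame x₀ i x)⟩ : TotalSpace F V)) (Q.chartSet x₀) x₀) :
    ContMDiff ((𝓡 b).prod 𝓘(ℝ, EuclideanSpace ℝ (Fin Q.rank))) ((𝓡 m).prod 𝓘(ℝ, F)) ∞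
      (fun q : Q.Total => (⟨f q.proj, ψ q.proj q.snd⟩ : TotalSpace F V)) := by
  intro q₀
  set e := trivializationAt (EuclideanSpace ℝ (Fin Q.rank)) Q.Fiber q₀.proj
  have hpr : ContMDiff ((𝓡 b).prod 𝓘(ℝ, EuclideanSpace ℝ (Fin Q.rank))) (𝓡 b) ∞
      (fun q : Q.Total => q.proj) := contMDiff_proj Q.Fiber
  have hq₀ : q₀ ∈ e.source := FiberBundle.mem_trivializationAt_proj_source
  have hnhds : e.source ∈ 𝓝 q₀ := e.open_source.mem_nhds hq₀
  have hcoef : ∀ i, ContMDiffAt ((𝓡 b).prod 𝓘(ℝ, EuclideanSpace ℝ (Fin Q.rank))) 𝓘(ℝ, ℝ) ∞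
      (fun q : Q.Total => (e q).2 i) q₀ := fun i =>
    (EuclideanSpace.proj (𝕜 := ℝ) i).contMDiff.contMDiffAt.comp q₀
      ((e.contMDiffAt_iff hq₀).1 contMDiffAt_id).2
  have hfr : ∀ i, ContMDiffAt ((𝓡 b).prod 𝓘(ℝ, EuclideanSpace ℝ (Fin Q.rank)))
      ((𝓡 m).prod 𝓘(ℝ, F)) ∞
      (fun q : Q.Total => (⟨f q.proj, ψ q.proj (Q.frame q₀.proj i q.proj)⟩ : TotalSpace F V))
      q₀ := fun i =>
    ((hψ q₀.proj i).contMDiffAt (e.open_baseSet.mem_nhds (Q.mem_chartSet q₀.proj))).comp q₀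
      (hpr q₀)
  -- A vector is expanded in the frame at the base point of q₀; the coefficients are smooth
  -- functions on the total space.
  have hsum : ContMDiffAt ((𝓡 b).prod 𝓘(ℝ, EuclideanSpace ℝ (Fin Q.rank)))
      ((𝓡 m).prod 𝓘(ℝ, F)) ∞
      (fun q : Q.Total => (⟨f q.proj, ∑ i, (e q).2 i •
        ψ q.proj (Q.frame q₀.proj i q.proj)⟩ : TotalSpace F V)) q₀ :=
    contMDiffWithinAt_sum_along _ ((hf.comp hpr) q₀) fun i _ =>
      contMDiffWithinAt_smul_along (hcoef i) (hfr i)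
  refine hsum.congr_of_eventuallyEq ?_
  filter_upwards [hnhds] with q hq
  have h := Q.sum_coef_frame q₀.proj (y := q.proj) (e.mem_source.1 hq) q.snd
  conv_lhs => rw [← h, map_sum]
  simp only [map_smul]
  rfl

end BundleMap

/-! ### Kernels of a smooth family of linear maps -/

section KernelChart

variable {b : ℕ} {B : Type*} [TopologicalSpace B] [ChartedSpace (EuclideanSpace ℝ (Fin b)) B]
  {V : Type*} [NormedAddCommGroup V] [NormedSpace ℝ V] [FiniteDimensional ℝ V]
  {W : Type*} [NormedAddCommGroup W] [NormedSpace ℝ W] [FiniteDimensional ℝ W]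

/-- Near a point, the kernels of a smooth family of linear maps are contained in the images of a
smooth family of linear maps from the kernel at that point. -/
theorem exists_kernel_chart {T : B → V →L[ℝ] W} {U : Set B} (hU : IsOpen U)
    (hT : ContMDiffOn (𝓡 b) 𝓘(ℝ, V →L[ℝ] W) ∞ T U) {x₀ : B} (hx₀ : x₀ ∈ U) {p : ℕ}
    (hp : Module.finrank ℝ (LinearMap.ker (T x₀).toLinearMap) = p) :
    ∃ (q : V →L[ℝ] EuclideanSpace ℝ (Fin p)) (s : B → EuclideanSpace ℝ (Fin p) →L[ℝ] V)
      (U' : Set B), IsOpen U' ∧ U' ⊆ U ∧ x₀ ∈ U' ∧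
      ContMDiffOn (𝓡 b) 𝓘(ℝ, EuclideanSpace ℝ (Fin p) →L[ℝ] V) ∞ s U' ∧
      ∀ x ∈ U', ∀ v, T x v = 0 → s x (q v) = v := by
  set K := LinearMap.ker (T x₀).toLinearMap
  obtain ⟨r, hr⟩ := K.subtype.exists_leftInverse_of_injective (Submodule.ker_subtype K)
  let φ : K ≃ₗ[ℝ] EuclideanSpace ℝ (Fin p) := LinearEquiv.ofFinrankEq _ _ (by simp [hp])
  let q : V →L[ℝ] EuclideanSpace ℝ (Fin p) :=
    LinearMap.toContinuousLinearMap (φ.toLinearMap ∘ₗ r)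
  -- At x₀ this is injective: a vector killed by T x₀ lies in K, where r is the identity and q
  -- therefore injective.
  let G : B → V →L[ℝ] EuclideanSpace ℝ (Fin p) × W := fun x => q.prod (T x)
  have hinj : LinearMap.ker (G x₀).toLinearMap = ⊥ := by
    refine LinearMap.ker_eq_bot'.2 fun v hv => ?_
    have h1 : q v = 0 := congrArg Prod.fst hv
    have h2 : T x₀ v = 0 := congrArg Prod.snd hv
    have h3 : r v = 0 := φ.map_eq_zero_iff.1 h1
    have h4 : r v = ⟨v, h2⟩ := LinearMap.congr_fun hr ⟨v, h2⟩
    rw [h4] at h3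
    exact congrArg Subtype.val h3
  obtain ⟨l, hl⟩ := (G x₀).toLinearMap.exists_leftInverse_of_injective hinj
  let L : EuclideanSpace ℝ (Fin p) × W →L[ℝ] V := LinearMap.toContinuousLinearMap l
  have hG : ContMDiffOn (𝓡 b) 𝓘(ℝ, V →L[ℝ] EuclideanSpace ℝ (Fin p) × W) ∞ G U := by
    refine contMDiffOn_clm_of_apply fun v => ?_
    exact contMDiffOn_const.prodMk_space (hT.clm_apply contMDiffOn_const)
  have hLG : ContMDiffOn (𝓡 b) 𝓘(ℝ, V →L[ℝ] V) ∞ (fun x => L.comp (G x)) U :=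
    contMDiffOn_const.clm_comp hG
  have h0 : L.comp (G x₀) = 1 := by
    ext v
    exact LinearMap.congr_fun hl v
  -- L ∘ G x is the identity at x₀, hence invertible nearby. If T x v = 0, then G x v = (q v, 0), so
  -- v = (L ∘ G x)⁻¹ L (q v, 0).
  refine ⟨q, fun x => (Ring.inverse (L.comp (G x))).comp (L.comp (ContinuousLinearMap.inl ℝ _ _)),
    U ∩ (fun x => L.comp (G x)) ⁻¹' {T | IsUnit T}, ?_, inter_subset_left, ⟨hx₀, ?_⟩, ?_, ?_⟩
  · exact hLG.continuousOn.isOpen_inter_preimage hU Units.isOpen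
  · simp [h0]
  · exact (contMDiffOn_inverse (hLG.mono inter_subset_left) fun x hx => hx.2).clm_comp
      contMDiffOn_const
  · intro x hx v hv
    have h1 : (L.comp (ContinuousLinearMap.inl ℝ _ _)) (q v) = (L.comp (G x)) v := by
      simp [G, hv]
    have h2 := Ring.inverse_mul_cancel _ hx.2
    simp only [ContinuousLinearMap.comp_apply] at h1 ⊢
    rw [h1]
    exact DFunLike.congr_fun h2 v

end KernelChart

/-! ### The map (a, w) ↦ ρ(a) − f_*w in coordinates -/

section Pullback

variable {b : ℕ} {B : Type uB} [TopologicalSpace B]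
  [ChartedSpace (EuclideanSpace ℝ (Fin b)) B] [IsManifold (𝓡 b) ∞ B]
  {m : ℕ} {M : Type uM} [TopologicalSpace M]
  [ChartedSpace (EuclideanSpace ℝ (Fin m)) M] [IsManifold (𝓡 m) ∞ M]

variable (b)

/-- The vector bundle `f^!A`, up to identification. -/
structure PullbackBundle (f : B → M) (A : LieAlgebroid.{uM, v} m M) extends
    SmoothVectorBundle.{uB, w} b B where
  /-- the first projection -/
  proj : ∀ x, Fiber x →ₗ[ℝ] A.Fiber (f x)
  contMDiff_proj : ContMDiff ((𝓡 b).prod 𝓘(ℝ, EuclideanSpace ℝ (Fin rank)))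
    ((𝓡 m).prod 𝓘(ℝ, EuclideanSpace ℝ (Fin A.rank))) ∞
    (fun p : toSmoothVectorBundle.Total => (⟨f p.proj, proj p.proj p.snd⟩ : A.Total))
  /-- the second projection -/
  anchor : ∀ x, Fiber x →ₗ[ℝ] TangentSpace (𝓡 b) x
  contMDiff_anchor : ContMDiff ((𝓡 b).prod 𝓘(ℝ, EuclideanSpace ℝ (Fin rank))) (𝓡 b).tangent ∞
    (fun p : toSmoothVectorBundle.Total =>
      (⟨p.proj, anchor p.proj p.snd⟩ : TangentBundle (𝓡 b) B))
  bijOn : ∀ x, Set.BijOn (fun v => (proj x v, anchor x v)) Set.univ (pullbackFiber f A x)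

variable (f : B → M) (A : LieAlgebroid.{uM, v} m M)

/-- The linear map `(a, w) ↦ ρ(a) - f_* w`. -/
def anchorDiff (x : B) : A.Fiber (f x) × TangentSpace (𝓡 b) x →ₗ[ℝ] TangentSpace (𝓡 m) (f x) :=
  (A.anchor (f x)).coprod (-(mfderiv (𝓡 b) (𝓡 m) f x).toLinearMap)

/-- The fibre of `f^!A` as a subspace. -/
abbrev pullbackSubspace (x : B) : Submodule ℝ (A.Fiber (f x) × TangentSpace (𝓡 b) x) :=
  LinearMap.ker (anchorDiff b f A x)

omit [IsManifold (𝓡 b) ∞ B] in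
theorem mem_pullbackSubspace {x : B} {p : A.Fiber (f x) × TangentSpace (𝓡 b) x} :
    p ∈ pullbackSubspace b f A x ↔ p ∈ pullbackFiber f A x := by
  simp only [pullbackSubspace, anchorDiff, LinearMap.mem_ker, LinearMap.coprod_apply,
    LinearMap.neg_apply, ← sub_eq_add_neg, sub_eq_zero]
  rfl

/-- The model of the bundle `f^*A ⊕ TB`. -/
abbrev sumModel (A : LieAlgebroid.{uM, v} m M) (b : ℕ) : Type :=
  EuclideanSpace ℝ (Fin A.rank) × EuclideanSpace ℝ (Fin b)

/-- Coordinates on `f^*A ⊕ TB` near `x₀`. -/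
def sumCoord (x₀ x : B) : A.Fiber (f x) × TangentSpace (𝓡 b) x →ₗ[ℝ] sumModel A b :=
  ((trivializationAt (EuclideanSpace ℝ (Fin A.rank)) A.Fiber (f x₀)).linearMapAt ℝ (f x)).prodMap
  ((trivializationAt (EuclideanSpace ℝ (Fin b)) (TangentSpace (𝓡 b) : B → Type) x₀).linearMapAt
    ℝ x)

/-- The inverse of the coordinates on `f^*A ⊕ TB` near `x₀`. -/
def sumCoordSymm (x₀ x : B) : sumModel A b →ₗ[ℝ] A.Fiber (f x) × TangentSpace (𝓡 b) x :=
  ((trivializationAt (EuclideanSpace ℝ (Fin A.rank)) A.Fiber (f x₀)).symmL ℝ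
    (f x)).toLinearMap.prodMap
  ((trivializationAt (EuclideanSpace ℝ (Fin b)) (TangentSpace (𝓡 b) : B → Type) x₀).symmL
    ℝ x).toLinearMap

/-- The domain of the coordinates near `x₀`. -/
def sumSet (x₀ : B) : Set B :=
  f ⁻¹' (trivializationAt (EuclideanSpace ℝ (Fin A.rank)) A.Fiber (f x₀)).baseSet ∩
  (trivializationAt (EuclideanSpace ℝ (Fin b)) (TangentSpace (𝓡 b) : B → Type) x₀).baseSet ∩
  f ⁻¹' (trivializationAt (EuclideanSpace ℝ (Fin m)) (TangentSpace (𝓡 m) : M → Type)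
    (f x₀)).baseSet

/-- The map `(a, w) ↦ ρ(a) - f_* w` in coordinates. -/
def anchorDiffCoord (x₀ x : B) : sumModel A b →L[ℝ] EuclideanSpace ℝ (Fin m) :=
  LinearMap.toContinuousLinearMap
    ((trivializationAt (EuclideanSpace ℝ (Fin m)) (TangentSpace (𝓡 m) : M → Type)
      (f x₀)).linearMapAt ℝ (f x) ∘ₗ anchorDiff b f A x ∘ₗ sumCoordSymm b f A x₀ x)

theorem mem_sumSet (x₀ : B) : x₀ ∈ sumSet b f A x₀ :=
  ⟨⟨FiberBundle.mem_baseSet_trivializationAt _ _ (f x₀),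
    FiberBundle.mem_baseSet_trivializationAt _ _ x₀⟩,
    FiberBundle.mem_baseSet_trivializationAt (EuclideanSpace ℝ (Fin m))
      (TangentSpace (𝓡 m) : M → Type) (f x₀)⟩

variable {b} {f}

theorem isOpen_sumSet (hf : Continuous f) (x₀ : B) : IsOpen (sumSet b f A x₀) :=
  (((trivializationAt _ _ _).open_baseSet.preimage hf).inter
    (trivializationAt _ _ _).open_baseSet).inter ((trivializationAt _ _ _).open_baseSet.preimage hf)

variable {A}

theorem sumCoordSymm_sumCoord {x₀ x : B} (hx : x ∈ sumSet b f A x₀)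
    (p : A.Fiber (f x) × TangentSpace (𝓡 b) x) :
    sumCoordSymm b f A x₀ x (sumCoord b f A x₀ x p) = p := by
  refine Prod.ext ?_ ?_
  · exact Trivialization.symmL_continuousLinearMapAt _ hx.1.1 p.1
  · exact Trivialization.symmL_continuousLinearMapAt _ hx.1.2 p.2

theorem sumCoord_sumCoordSymm {x₀ x : B} (hx : x ∈ sumSet b f A x₀) (c : sumModel A b) :
    sumCoord b f A x₀ x (sumCoordSymm b f A x₀ x c) = c := by
  refine Prod.ext ?_ ?_
  · exact Trivialization.continuousLinearMapAt_symmL _ hx.1.1 c.1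
  · exact Trivialization.continuousLinearMapAt_symmL _ hx.1.2 c.2

/-- The trivialization of TM is injective on the fibre over f x, so coordinates on the target do not
change the kernel. -/
theorem anchorDiffCoord_eq_zero_iff {x₀ x : B} (hx : x ∈ sumSet b f A x₀) (c : sumModel A b) :
    anchorDiffCoord b f A x₀ x c = 0 ↔ sumCoordSymm b f A x₀ x c ∈ pullbackSubspace b f A x := by
  rw [LinearMap.mem_ker]
  constructor
  · intro h
    have h' := Trivialization.symmL_continuousLinearMapAt (R := ℝ)
      (trivializationAt (EuclideanSpace ℝ (Fin m)) (TangentSpace (𝓡 m) : M → Type)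
      (f x₀)) hx.2 (anchorDiff b f A x (sumCoordSymm b f A x₀ x c))
    rw [← h']
    exact (congrArg _ h).trans (map_zero _)
  · intro h
    exact (congrArg ((trivializationAt (EuclideanSpace ℝ (Fin m)) (TangentSpace (𝓡 m) : M → Type)
      (f x₀)).linearMapAt ℝ (f x)) h).trans (map_zero _)

theorem contMDiffOn_sumCoordSymm_fst (hf : ContMDiff (𝓡 b) (𝓡 m) ∞ f) (x₀ : B) {s : Set B}
    (hs : s ⊆ sumSet b f A x₀) {c : B → sumModel A b}
    (hc : ContMDiffOn (𝓡 b) 𝓘(ℝ, sumModel A b) ∞ c s) :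
    ContMDiffOn (𝓡 b) ((𝓡 m).prod 𝓘(ℝ, EuclideanSpace ℝ (Fin A.rank))) ∞
      (fun x => (⟨f x, (sumCoordSymm b f A x₀ x (c x)).1⟩ : A.Total)) s := by
  refine (contMDiffOn_symm_along
    (trivializationAt (EuclideanSpace ℝ (Fin A.rank)) A.Fiber (f x₀)) hf.contMDiffOn
    (fun x hx => (hs hx).1.1) (c := fun x => (c x).1) ?_).congr fun x hx => ?_
  · exact (ContinuousLinearMap.fst ℝ _ _).contMDiff.comp_contMDiffOn hc
  · exact congrArg _ (Trivialization.symmL_apply _ (hs hx).1.1 _)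

theorem contMDiffOn_sumCoordSymm_snd (x₀ : B) {s : Set B}
    (hs : s ⊆ sumSet b f A x₀) {c : B → sumModel A b}
    (hc : ContMDiffOn (𝓡 b) 𝓘(ℝ, sumModel A b) ∞ c s) :
    ContMDiffOn (𝓡 b) (𝓡 b).tangent ∞
      (fun x => (⟨x, (sumCoordSymm b f A x₀ x (c x)).2⟩ : TangentBundle (𝓡 b) B)) s := by
  refine (contMDiffOn_symm_along
    (trivializationAt (EuclideanSpace ℝ (Fin b)) (TangentSpace (𝓡 b) : B → Type) x₀)
    contMDiffOn_id (fun x hx => (hs hx).1.2) (c := fun x => (c x).2) ?_).congr fun x hx => ?_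
  · exact (ContinuousLinearMap.snd ℝ _ _).contMDiff.comp_contMDiffOn hc
  · exact congrArg _ (Trivialization.symmL_apply _ (hs hx).1.2 _)

theorem contMDiffOn_sumCoord (x₀ : B) {s : Set B} (hs : s ⊆ sumSet b f A x₀)
    {a : ∀ x, A.Fiber (f x)} {w : ∀ x, TangentSpace (𝓡 b) x}
    (ha : ContMDiffOn (𝓡 b) ((𝓡 m).prod 𝓘(ℝ, EuclideanSpace ℝ (Fin A.rank))) ∞
      (fun x => (⟨f x, a x⟩ : A.Total)) s)
    (hw : ContMDiffOn (𝓡 b) (𝓡 b).tangent ∞ (fun x => (⟨x, w x⟩ : TangentBundle (𝓡 b) B)) s) :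
    ContMDiffOn (𝓡 b) 𝓘(ℝ, sumModel A b) ∞ (fun x => sumCoord b f A x₀ x (a x, w x)) s := by
  refine ContMDiffOn.congr (ContMDiffOn.prodMk_space
    (contMDiffOn_coord_along (trivializationAt _ A.Fiber (f x₀)) (fun x hx => (hs hx).1.1) ha)
    (contMDiffOn_coord_along (trivializationAt _ (TangentSpace (𝓡 b) : B → Type) x₀) (g := id)
      (fun x hx => (hs hx).1.2) hw)) fun x hx => ?_
  refine Prod.ext ?_ ?_
  · exact congrFun (Trivialization.coe_linearMapAt_of_mem _ (hs hx).1.1) _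
  · exact congrFun (Trivialization.coe_linearMapAt_of_mem _ (hs hx).1.2) _

/-- It suffices to fix a vector of the model. Its two components are smooth sections of f^*A and TB;
the anchor and the tangent map of f send them to smooth sections of TM along f, which can be
subtracted there. -/
theorem contMDiffOn_anchorDiffCoord (hf : ContMDiff (𝓡 b) (𝓡 m) ∞ f) (x₀ : B) :
    ContMDiffOn (𝓡 b) 𝓘(ℝ, sumModel A b →L[ℝ] EuclideanSpace ℝ (Fin m)) ∞
      (anchorDiffCoord b f A x₀) (sumSet b f A x₀) := by
  refine contMDiffOn_clm_of_apply fun c => ?_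
  have h1 := A.contMDiff_anchor.comp_contMDiffOn
    (contMDiffOn_sumCoordSymm_fst hf x₀ Subset.rfl (contMDiffOn_const (c := c)))
  have h2 := (hf.contMDiff_tangentMap (m := ∞) (by simp)).comp_contMDiffOn
    (contMDiffOn_sumCoordSymm_snd (f := f) (A := A) x₀ Subset.rfl (contMDiffOn_const (c := c)))
  have h3 : ContMDiffOn (𝓡 b) (𝓡 m).tangent ∞
      (fun x => (⟨f x, A.anchor (f x) (sumCoordSymm b f A x₀ x c).1 +
        (-1 : ℝ) • mfderiv (𝓡 b) (𝓡 m) f x (sumCoordSymm b f A x₀ x c).2⟩ : TangentBundle (𝓡 m) M))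
      (sumSet b f A x₀) := fun x hx =>
    contMDiffWithinAt_add_along (h1 x hx)
      (contMDiffWithinAt_smul_along contMDiffWithinAt_const (h2 x hx))
  refine ContMDiffOn.congr (contMDiffOn_coord_along
    (trivializationAt _ (TangentSpace (𝓡 m) : M → Type) (f x₀))
    (fun x hx => hx.2) h3) fun x hx => ?_
  refine (congrFun (Trivialization.coe_linearMapAt_of_mem _ hx.2) _).trans ?_
  simp only [anchorDiff, LinearMap.comp_apply, LinearMap.coprod_apply, LinearMap.neg_apply,
    neg_smul, one_smul]
  rfl

end Pullback

/-! ### The vector bundle f^!A -/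

section Pullback

variable {b : ℕ} {B : Type uB} [TopologicalSpace B]
  [ChartedSpace (EuclideanSpace ℝ (Fin b)) B] [IsManifold (𝓡 b) ∞ B]
  {m : ℕ} {M : Type uM} [TopologicalSpace M]
  [ChartedSpace (EuclideanSpace ℝ (Fin m)) M] [IsManifold (𝓡 m) ∞ M]
  (f : B → M) (A : LieAlgebroid.{uM, v} m M)

instance {m : ℕ} {M : Type*} [TopologicalSpace M] [ChartedSpace (EuclideanSpace ℝ (Fin m)) M]
    (x : M) : FiniteDimensional ℝ (TangentSpace (𝓡 m) x) :=
  inferInstanceAs (FiniteDimensional ℝ (EuclideanSpace ℝ (Fin m)))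

/-- The linear identification of a fibre with the model. -/
def SmoothVectorBundle.fiberEquiv {m : ℕ} {M : Type*} [TopologicalSpace M]
    [ChartedSpace (EuclideanSpace ℝ (Fin m)) M] (A : SmoothVectorBundle m M) (x : M) :
    A.Fiber x ≃ₗ[ℝ] EuclideanSpace ℝ (Fin A.rank) :=
  (trivializationAt (EuclideanSpace ℝ (Fin A.rank)) A.Fiber x).linearEquivAt ℝ x
    (A.mem_chartSet x)

instance {m : ℕ} {M : Type*} [TopologicalSpace M]
    [ChartedSpace (EuclideanSpace ℝ (Fin m)) M] (A : SmoothVectorBundle m M) (x : M) :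
    FiniteDimensional ℝ (A.Fiber x) :=
  (A.fiberEquiv x).symm.finiteDimensional

-- Rank–nullity, as the range of (a, w) ↦ ρ(a) − f_*w is ρ(A_{f(x)}) + f_*(T_x B). The natural
-- subtraction does not truncate, since r plus the kernel dimension equals `A.rank + b`.
omit [IsManifold (𝓡 b) ∞ B] in
theorem finrank_pullbackSubspace {r : ℕ} (x : B) (hr : Module.finrank ℝ
    ↥(LinearMap.range (A.anchor (f x)) ⊔
      LinearMap.range (mfderiv (𝓡 b) (𝓡 m) f x).toLinearMap) = r) :
    Module.finrank ℝ (pullbackSubspace b f A x) = A.rank + b - r := by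
  change Module.finrank ℝ (LinearMap.ker (anchorDiff b f A x)) = _
  have h1 := LinearMap.finrank_range_add_finrank_ker (anchorDiff b f A x)
  have h2 : LinearMap.range (anchorDiff b f A x) = LinearMap.range (A.anchor (f x)) ⊔
      LinearMap.range (mfderiv (𝓡 b) (𝓡 m) f x).toLinearMap := by
    rw [anchorDiff, LinearMap.range_coprod, LinearMap.range_neg]
  have h3 : Module.finrank ℝ (A.Fiber (f x)) = A.rank :=
    (A.fiberEquiv (f x)).finrank_eq.trans finrank_euclideanSpace_fin
  have h4 : Module.finrank ℝ (TangentSpace (𝓡 b) x) = b := finrank_euclideanSpace_fin (𝕜 := ℝ)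
  rw [h2, hr, Module.finrank_prod, h3, h4] at h1
  omega

/-- The coordinates restrict to an isomorphism of kernels. -/
def kerCoordEquiv {f : B → M} {A : LieAlgebroid.{uM, v} m M} {x₀ x : B} (hx : x ∈ sumSet b f A x₀) :
    pullbackSubspace b f A x ≃ₗ[ℝ] LinearMap.ker (anchorDiffCoord b f A x₀ x).toLinearMap where
  toFun p := ⟨sumCoord b f A x₀ x p, by
    rw [LinearMap.mem_ker]
    refine (anchorDiffCoord_eq_zero_iff hx _).2 ?_
    rw [sumCoordSymm_sumCoord hx]
    exact p.2⟩
  map_add' p q := by ext1; simp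
  map_smul' c p := by ext1; simp
  invFun c := ⟨sumCoordSymm b f A x₀ x c, (anchorDiffCoord_eq_zero_iff hx _).1 c.2⟩
  left_inv p := by ext1; exact sumCoordSymm_sumCoord hx _
  right_inv c := by ext1; exact sumCoord_sumCoordSymm hx _

variable (b) in
/-- A chart of `f^!A` at `x₀`: linear coordinates `q` on the model of `f^*A ⊕ TB` and a smooth
family `s` of inverses on the subspaces. -/
structure KernelChart (p : ℕ) (x₀ : B) where
  /-- the linear coordinates -/
  q : sumModel A b →L[ℝ] EuclideanSpace ℝ (Fin p)
  /-- the inverses -/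
  s : B → EuclideanSpace ℝ (Fin p) →L[ℝ] sumModel A b
  /-- the domain -/
  U : Set B
  isOpen : IsOpen U
  subset : U ⊆ sumSet b f A x₀
  mem : x₀ ∈ U
  smooth : ContMDiffOn (𝓡 b) 𝓘(ℝ, EuclideanSpace ℝ (Fin p) →L[ℝ] sumModel A b) ∞ s U
  s_q : ∀ x ∈ U, ∀ v, anchorDiffCoord b f A x₀ x v = 0 → s x (q v) = v

variable {f A}

theorem exists_kernelChart (hf : ContMDiff (𝓡 b) (𝓡 m) ∞ f) {p : ℕ}
    (hp : ∀ x : B, Module.finrank ℝ (pullbackSubspace b f A x) = p) (x₀ : B) :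
    Nonempty (KernelChart b f A p x₀) := by
  obtain ⟨q, s, U, h1, h2, h3, h4, h5⟩ := exists_kernel_chart
    (isOpen_sumSet (b := b) A hf.continuous x₀) (contMDiffOn_anchorDiffCoord hf x₀)
    (mem_sumSet b f A x₀) (p := p)
    ((kerCoordEquiv (mem_sumSet b f A x₀)).finrank_eq.symm.trans (hp x₀))
  exact ⟨⟨q, s, U, h1, h2, h3, h4, h5⟩⟩

/-- The coordinate map of a chart of `f^!A`. -/
def KernelChart.coord {p : ℕ} {x₀ : B} (C : KernelChart b f A p x₀) (x : B) :
    pullbackSubspace b f A x →ₗ[ℝ] EuclideanSpace ℝ (Fin p) :=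
  C.q.toLinearMap ∘ₗ sumCoord b f A x₀ x ∘ₗ (pullbackSubspace b f A x).subtype

theorem KernelChart.s_coord {p : ℕ} {x₀ : B} (C : KernelChart b f A p x₀) {x : B} (hx : x ∈ C.U)
    (w : pullbackSubspace b f A x) : sumCoordSymm b f A x₀ x (C.s x (C.coord x w)) = w := by
  have h : C.s x (C.coord x w) = sumCoord b f A x₀ x w := by
    refine C.s_q x hx _ ((anchorDiffCoord_eq_zero_iff (C.subset hx) _).2 ?_)
    exact (sumCoordSymm_sumCoord (C.subset hx) w.1).symm ▸ w.2
  rw [h, sumCoordSymm_sumCoord (C.subset hx)]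

open scoped Classical in
/-- The chart as a linear equivalence. -/
def KernelChart.equiv {p : ℕ} {x₀ : B} (C : KernelChart b f A p x₀)
    (hp : ∀ x : B, Module.finrank ℝ (pullbackSubspace b f A x) = p) (x : B) :
    pullbackSubspace b f A x ≃ₗ[ℝ] EuclideanSpace ℝ (Fin p) :=
  -- Over `C.U` the coordinate map is injective, hence bijective because the dimensions agree.
  -- Elsewhere an arbitrary isomorphism serves as default value, since `BundleCharts` asks for a
  -- chart over every point.
  if h : Function.Injective (C.coord x) then
    LinearEquiv.ofInjectiveOfFinrankEq (C.coord x) h (by simp [hp])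
  else LinearEquiv.ofFinrankEq _ _ (by simp [hp])

theorem KernelChart.equiv_apply {p : ℕ} {x₀ : B} (C : KernelChart b f A p x₀)
    (hp : ∀ x : B, Module.finrank ℝ (pullbackSubspace b f A x) = p) {x : B} (hx : x ∈ C.U)
    (w : pullbackSubspace b f A x) : C.equiv hp x w = C.coord x w := by
  have h : Function.Injective (C.coord x) := fun w w' hw => by
    rw [Subtype.ext_iff, ← C.s_coord hx w, hw, C.s_coord hx w']
  rw [KernelChart.equiv, dif_pos h]
  rfl

/-- The inverse chart, given abstractly by a dimension count, is the explicit smooth family `C.s`;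
smoothness of frames and of coordinate changes rests on this. -/
theorem KernelChart.equiv_symm {p : ℕ} {x₀ : B} (C : KernelChart b f A p x₀)
    (hp : ∀ x : B, Module.finrank ℝ (pullbackSubspace b f A x) = p) {x : B} (hx : x ∈ C.U)
    (c : EuclideanSpace ℝ (Fin p)) :
    ((C.equiv hp x).symm c : A.Fiber (f x) × TangentSpace (𝓡 b) x) =
      sumCoordSymm b f A x₀ x (C.s x c) := by
  have h := C.s_coord hx ((C.equiv hp x).symm c)
  rw [← C.equiv_apply hp hx, LinearEquiv.apply_symm_apply] at h
  exact h.symm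

/-- The linear charts of `f^!A`. -/
def pullbackCharts (hf : ContMDiff (𝓡 b) (𝓡 m) ∞ f) {p : ℕ}
    (hp : ∀ x : B, Module.finrank ℝ (pullbackSubspace b f A x) = p)
    (C : ∀ x₀, KernelChart b f A p x₀) : BundleCharts b p fun x => pullbackSubspace b f A x where
  baseSet x₀ := (C x₀).U
  isOpen_baseSet x₀ := (C x₀).isOpen
  mem_baseSet x₀ := (C x₀).mem
  chart x₀ x := (C x₀).equiv hp x
  exists_change x₀ x₁ := by
    refine ⟨fun x => LinearMap.toContinuousLinearMap ((C x₁).q.toLinearMap ∘ₗ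
      sumCoord b f A x₁ x ∘ₗ sumCoordSymm b f A x₀ x ∘ₗ ((C x₀).s x).toLinearMap), ?_, ?_⟩
    · refine contMDiffOn_clm_of_apply fun c => ?_
      have hs : ContMDiffOn (𝓡 b) 𝓘(ℝ, sumModel A b) ∞ (fun x => (C x₀).s x c)
          ((C x₀).U ∩ (C x₁).U) :=
        ((C x₀).smooth.clm_apply contMDiffOn_const).mono inter_subset_left
      exact (C x₁).q.contMDiff.comp_contMDiffOn (contMDiffOn_sumCoord x₁
        (inter_subset_right.trans (C x₁).subset)
        (contMDiffOn_sumCoordSymm_fst hf x₀ (inter_subset_left.trans (C x₀).subset) hs)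
        (contMDiffOn_sumCoordSymm_snd x₀ (inter_subset_left.trans (C x₀).subset) hs))
    · intro x hx c
      rw [(C x₁).equiv_apply hp hx.2]
      simp only [KernelChart.coord, LinearMap.comp_apply, Submodule.subtype_apply,
        (C x₀).equiv_symm hp hx.1]
      rfl

/-- The vector bundle `f^!A` exists. -/
theorem exists_pullbackBundle (hf : ContMDiff (𝓡 b) (𝓡 m) ∞ f)
    (hA : PullbackIsSmooth (b := b) f A) : Nonempty (PullbackBundle.{uB, uM, v, v} b f A) := by
  obtain ⟨r, hr⟩ := hA
  have hp : ∀ x : B, Module.finrank ℝ (pullbackSubspace b f A x) = A.rank + b - r :=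
    fun x => finrank_pullbackSubspace f A x (hr x)
  let C : ∀ x₀, KernelChart b f A (A.rank + b - r) x₀ := fun x₀ =>
      (exists_kernelChart hf hp x₀).some
  let D := pullbackCharts hf hp C
  have hs : ∀ x₀ (c : EuclideanSpace ℝ (Fin (A.rank + b - r))),
      ContMDiffOn (𝓡 b) 𝓘(ℝ, sumModel A b) ∞ (fun x => (C x₀).s x c) (C x₀).U :=
    fun x₀ c => (C x₀).smooth.clm_apply contMDiffOn_const
  -- Inside f^*A ⊕ TB the frame is given by the smooth family s, so both projections are smooth on
  -- it, which is enough for smoothness on the total space.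
  have hfr : ∀ x₀ i, ∀ x ∈ (C x₀).U, (D.toBundle.frame x₀ i x).1 =
      sumCoordSymm b f A x₀ x ((C x₀).s x (EuclideanSpace.single i 1)) := fun x₀ i x hx =>
    (congrArg Subtype.val (D.toBundle_symm x₀ (x := x) hx _)).trans ((C x₀).equiv_symm hp hx _)
  refine ⟨{ D.toBundle with
    proj := fun x => LinearMap.fst ℝ _ _ ∘ₗ (pullbackSubspace b f A x).subtype
    contMDiff_proj := ?_
    anchor := fun x => LinearMap.snd ℝ _ _ ∘ₗ (pullbackSubspace b f A x).subtype
    contMDiff_anchor := ?_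
    bijOn := ?_ }⟩
  · refine D.toBundle.contMDiff_of_frame (V := A.Fiber) hf
      (fun x => LinearMap.fst ℝ _ _ ∘ₗ (pullbackSubspace b f A x).subtype) fun x₀ i => ?_
    refine ContMDiffOn.congr (contMDiffOn_sumCoordSymm_fst hf x₀ (C x₀).subset
      (hs x₀ (EuclideanSpace.single i 1))) (fun x hx => ?_) x₀ (C x₀).mem
    exact congrArg (fun u => (⟨f x, u.1⟩ : A.Total)) (hfr x₀ i x hx)
  · refine D.toBundle.contMDiff_of_frame (V := (TangentSpace (𝓡 b) : B → Type)) (f := fun x => x)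
      contMDiff_id (fun x => LinearMap.snd ℝ _ _ ∘ₗ (pullbackSubspace b f A x).subtype)
      fun x₀ i => ?_
    refine ContMDiffOn.congr (contMDiffOn_sumCoordSymm_snd x₀ (C x₀).subset
      (hs x₀ (EuclideanSpace.single i 1))) (fun x hx => ?_) x₀ (C x₀).mem
    exact congrArg (fun u => (⟨x, u.2⟩ : TangentBundle (𝓡 b) B)) (hfr x₀ i x hx)
  · intro x
    refine ⟨fun v _ => (mem_pullbackSubspace b f A).1 v.2, fun v _ v' _ h => Subtype.ext h,
      fun q hq => ⟨⟨q, (mem_pullbackSubspace b f A).2 hq⟩, mem_univ _, rfl⟩⟩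

end Pullback

/-! ### Derivatives of functions along tangent vectors and vector fields -/

section Derivative

variable {m : ℕ} {M : Type*} [TopologicalSpace M] [ChartedSpace (EuclideanSpace ℝ (Fin m)) M]

/-- The derivative along a tangent vector as a linear functional of that vector. -/
theorem dirDeriv_eq_mvfderiv (g : M → ℝ) (x : M) (v : TangentSpace (𝓡 m) x) :
    dirDeriv g x v = mvfderiv (𝓡 m) g x v := rfl

@[simp] theorem dirDeriv_zero_right (g : M → ℝ) (x : M) :
    dirDeriv g x (0 : TangentSpace (𝓡 m) x) = 0 := by
  simp [dirDeriv_eq_mvfderiv]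

theorem dirDeriv_add_right (g : M → ℝ) (x : M) (v w : TangentSpace (𝓡 m) x) :
    dirDeriv g x (v + w) = dirDeriv g x v + dirDeriv g x w := by
  simp [dirDeriv_eq_mvfderiv]

theorem dirDeriv_smul_right (g : M → ℝ) (x : M) (c : ℝ) (v : TangentSpace (𝓡 m) x) :
    dirDeriv g x (c • v) = c * dirDeriv g x v := by
  simp [dirDeriv_eq_mvfderiv]

theorem _root_.ContMDiffMap.mdiffAt (g : C^∞⟮𝓡 m, M; ℝ⟯) (x : M) :
    MDifferentiableAt (𝓡 m) 𝓘(ℝ, ℝ) g x :=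
  g.contMDiff.contMDiffAt.mdifferentiableAt (by simp)

theorem dirDeriv_add (g h : C^∞⟮𝓡 m, M; ℝ⟯) (x : M) (v : TangentSpace (𝓡 m) x) :
    dirDeriv (g + h : C^∞⟮𝓡 m, M; ℝ⟯) x v = dirDeriv g x v + dirDeriv h x v := by
  simp only [dirDeriv_eq_mvfderiv, ContMDiffMap.coe_add, mvfderiv_add (g.mdiffAt x) (h.mdiffAt x)]
  rfl

theorem dirDeriv_mul (g h : C^∞⟮𝓡 m, M; ℝ⟯) (x : M) (v : TangentSpace (𝓡 m) x) :
    dirDeriv (g * h : C^∞⟮𝓡 m, M; ℝ⟯) x v = g x * dirDeriv h x v + h x * dirDeriv g x v := by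
  simp only [dirDeriv_eq_mvfderiv, ContMDiffMap.coe_mul, mvfderiv_mul (g.mdiffAt x) (h.mdiffAt x)]
  rfl

theorem dirDeriv_const (c : ℝ) (x : M) (v : TangentSpace (𝓡 m) x) :
    dirDeriv (fun _ : M => c) x v = 0 := by
  simp only [dirDeriv_eq_mvfderiv, mvfderiv_const]
  rfl

theorem dirDeriv_smul (c : ℝ) (g : C^∞⟮𝓡 m, M; ℝ⟯) (x : M) (v : TangentSpace (𝓡 m) x) :
    dirDeriv (c • g : C^∞⟮𝓡 m, M; ℝ⟯) x v = c * dirDeriv g x v := by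
  have h := dirDeriv_mul (ContMDiffMap.const c) g x v
  rw [show (ContMDiffMap.const c * g : C^∞⟮𝓡 m, M; ℝ⟯) = c • g from rfl] at h
  rw [h, show dirDeriv (ContMDiffMap.const c : C^∞⟮𝓡 m, M; ℝ⟯) x v = 0 from dirDeriv_const c x v]
  simp [ContMDiffMap.const]

theorem dirDeriv_congr {g h : M → ℝ} {x : M} (hgh : ∀ᶠ y in 𝓝 x, g y = h y)
    (v : TangentSpace (𝓡 m) x) : dirDeriv g x v = dirDeriv h x v := by
  have h' : g =ᶠ[𝓝 x] h := hgh
  simp only [dirDeriv, h'.mfderiv_eq]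
  rfl

variable {b : ℕ} {B : Type*} [TopologicalSpace B] [ChartedSpace (EuclideanSpace ℝ (Fin b)) B]

theorem dirDeriv_comp {f : B → M} (hf : ContMDiff (𝓡 b) (𝓡 m) ∞ f) (g : C^∞⟮𝓡 m, M; ℝ⟯) (x : B)
    (w : TangentSpace (𝓡 b) x) :
    dirDeriv (fun y => g (f y)) x w = dirDeriv g (f x) (mfderiv (𝓡 b) (𝓡 m) f x w) :=
  mfderiv_comp_apply x (g.mdiffAt (f x)) (hf.contMDiffAt.mdifferentiableAt (by simp)) w

variable [IsManifold (𝓡 m) ∞ M]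

/-- The derivative of smooth functions along a vector field. -/
def VField.deriv (X : VField m M) : C^∞⟮𝓡 m, M; ℝ⟯ →ₗ[ℝ] C^∞⟮𝓡 m, M; ℝ⟯ where
  toFun g := ⟨fun x => dirDeriv g x (X x), by
    have h := (g.contMDiff.contMDiff_tangentMap (m := ∞) (by simp)).comp X.contMDiff
    exact (contMDiff_snd_tangentBundle_modelSpace ℝ 𝓘(ℝ, ℝ)).comp h⟩
  map_add' g h := by ext x; exact dirDeriv_add g h x _
  map_smul' c g := by ext x; exact dirDeriv_smul c g x _

theorem VField.deriv_apply (X : VField m M) (g : C^∞⟮𝓡 m, M; ℝ⟯) (x : M) :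
    X.deriv g x = dirDeriv g x (X x) := rfl

theorem VField.deriv_mul (X : VField m M) (g h : C^∞⟮𝓡 m, M; ℝ⟯) :
    X.deriv (g * h) = g * X.deriv h + h * X.deriv g := by
  ext x
  exact dirDeriv_mul g h x _

variable [T2Space M]

/-- Tangent vectors are determined by the derivatives of smooth functions. -/
theorem eq_of_dirDeriv_eq {x : M} {v w : TangentSpace (𝓡 m) x}
    (h : ∀ g : C^∞⟮𝓡 m, M; ℝ⟯, dirDeriv g x v = dirDeriv g x w) : v = w := by
  have : IsManifold (𝓡 m) 1 M := IsManifold.of_le (n := ∞) (by simp)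
  -- The chart at x has injective derivative there, so its coordinate functions separate tangent
  -- vectors; each of them is extended to M by a cutoff without changing its germ at x.
  have hinv := isInvertible_mfderiv_extChartAt (I := 𝓡 m) (mem_extChartAt_source (I := 𝓡 m) x)
  have hinj : Function.Injective (mfderiv (𝓡 m) 𝓘(ℝ, EuclideanSpace ℝ (Fin m))
      (extChartAt (𝓡 m) x) x) := by
    obtain ⟨e, he⟩ := hinv
    rw [← he]
    exact e.injective
  apply hinj
  refine PiLp.ext (p := 2) (α := fun _ : Fin m => ℝ) fun i => ?_
  have hU := isOpen_extChartAt_source (I := 𝓡 m) x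
  have hx := mem_extChartAt_source (I := 𝓡 m) x
  have hch := contMDiffOn_extChartAt (I := 𝓡 m) (x := x) (n := ∞)
  obtain ⟨k, -, -, hk⟩ := exists_global_eq (m := m) (x := x)
    (h := fun y => extChartAt (𝓡 m) x y i) (U := (extChartAt (𝓡 m) x).source) hU hx
    ((EuclideanSpace.proj (𝕜 := ℝ) i).contMDiff.comp_contMDiffOn (by
      rw [extChartAt_source]; exact hch))
  have h1 := h k
  rw [dirDeriv_congr hk, dirDeriv_congr hk] at h1
  have hd : MDifferentiableAt (𝓡 m) 𝓘(ℝ, EuclideanSpace ℝ (Fin m)) (extChartAt (𝓡 m) x) x :=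
    mdifferentiableAt_extChartAt (by simp)
  have h2 : ∀ u : TangentSpace (𝓡 m) x, dirDeriv (fun y => extChartAt (𝓡 m) x y i) x u =
      (EuclideanSpace.proj (𝕜 := ℝ) i : EuclideanSpace ℝ (Fin m) →L[ℝ] ℝ)
        (mfderiv (𝓡 m) 𝓘(ℝ, EuclideanSpace ℝ (Fin m)) (extChartAt (𝓡 m) x) x u) := by
    intro u
    refine (mfderiv_comp_apply (I := 𝓡 m) (I' := 𝓘(ℝ, EuclideanSpace ℝ (Fin m))) (I'' := 𝓘(ℝ, ℝ))
      (g := EuclideanSpace.proj (𝕜 := ℝ) i) (f := extChartAt (𝓡 m) x) x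
      (EuclideanSpace.proj (𝕜 := ℝ) i).differentiableAt.mdifferentiableAt hd u).trans ?_
    rw [mfderiv_eq_fderiv, ContinuousLinearMap.fderiv]
    rfl
  rw [h2, h2] at h1
  exact h1

end Derivative

/-! ### Locality of the bracket, and the anchor as a homomorphism -/

section Algebroid

variable {m : ℕ} {M : Type uM} [TopologicalSpace M] [ChartedSpace (EuclideanSpace ℝ (Fin m)) M]
  [IsManifold (𝓡 m) ∞ M] (A : LieAlgebroid.{uM, v} m M)

theorem LieAlgebroid.bracket_swap (a c : A.Sections) : A.bracket a c = -A.bracket c a := by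
  have h := A.bracket_self (a + c)
  simp only [map_add, LinearMap.add_apply, A.bracket_self, zero_add, add_zero] at h
  exact eq_neg_of_add_eq_zero_right h

theorem LieAlgebroid.leibniz_left (a c : A.Sections) (g : C^∞⟮𝓡 m, M; ℝ⟯) (x : M) :
    A.bracket (A.smulSection g a) c x =
      g x • A.bracket a c x - dirDeriv g x (A.anchor x (c x)) • a x := by
  rw [A.bracket_swap, A.bracket_swap a c, ContMDiffSection.coe_neg, ContMDiffSection.coe_neg,
    Pi.neg_apply, Pi.neg_apply, A.leibniz]
  module

omit [IsManifold (𝓡 m) ∞ M] in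
theorem SmoothVectorBundle.smulSection_apply (A : SmoothVectorBundle.{uM, v} m M)
    (g : C^∞⟮𝓡 m, M; ℝ⟯) (a : A.Sections) (x : M) : A.smulSection g a x = g x • a x := rfl

theorem LieAlgebroid.anchorSection_apply (a : A.Sections) (x : M) :
    A.anchorSection a x = A.anchor x (a x) := rfl

theorem LieAlgebroid.bracket_smulSection (a c : A.Sections) (g : C^∞⟮𝓡 m, M; ℝ⟯) :
    A.bracket a (A.smulSection g c) =
      A.smulSection ((A.anchorSection a).deriv g) c + A.smulSection g (A.bracket a c) := by
  ext x
  rw [A.leibniz]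
  rfl

variable [T2Space M]

/-- Every vector is the value of a section. -/
theorem SmoothVectorBundle.exists_section_eq (A : SmoothVectorBundle.{uM, v} m M) {y : M}
    (v : A.Fiber y) : ∃ c : A.Sections, c y = v := by
  obtain ⟨e, -, he⟩ := A.exists_global_frame y
  refine ⟨∑ i, A.coef y i v • e i, ?_⟩
  have h := ContMDiffSection.coeAddHom_apply (𝕜 := ℝ) (I := 𝓡 m)
    (F := EuclideanSpace ℝ (Fin A.rank)) (n := ∞) (V := A.Fiber) (∑ i, A.coef y i v • e i)
  rw [← h, map_sum, Finset.sum_apply]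
  have h2 := he.self_of_nhds
  conv_rhs => rw [← A.sum_coef_frame y h2.1 v]
  refine Finset.sum_congr rfl fun i _ => ?_
  rw [← h2.2 i]
  rfl

/-- The bracket is local. -/
theorem LieAlgebroid.bracket_eq_zero_of_eventually (a : A.Sections) {c : A.Sections} {y : M}
    (hc : ∀ᶠ z in 𝓝 y, c z = 0) : A.bracket a c y = 0 := by
  obtain ⟨U, hU, hUo, hy⟩ := eventually_nhds_iff.1 hc
  obtain ⟨χ, -, hs, h1⟩ := exists_bump (m := m) hUo hy
  -- In the Leibniz rule for (1 − χ)c at y, one term contains c y = 0 and the other 1 − χ(y) = 0.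
  have h : c = A.smulSection (1 - χ) c := by
    ext z
    rw [SmoothVectorBundle.smulSection_apply]
    by_cases hz : z ∈ U
    · simp [hU z hz]
    · have : χ z = 0 := image_eq_zero_of_notMem_tsupport fun h => hz (hs h)
      simp [this]
  rw [h, A.leibniz, hU y hy]
  simp [h1.self_of_nhds]

theorem LieAlgebroid.bracket_congr (a : A.Sections) {c d : A.Sections} {y : M}
    (hc : ∀ᶠ z in 𝓝 y, c z = d z) : A.bracket a c y = A.bracket a d y := by
  have h := A.bracket_eq_zero_of_eventually a (c := c - d) (y := y) (by
    filter_upwards [hc] with z hz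
    simp [hz])
  rw [map_sub, ContMDiffSection.coe_sub, Pi.sub_apply] at h
  exact sub_eq_zero.1 h

theorem LieAlgebroid.bracket_congr_left (a : A.Sections) {c d : A.Sections} {y : M}
    (hc : ∀ᶠ z in 𝓝 y, c z = d z) : A.bracket c a y = A.bracket d a y := by
  rw [A.bracket_swap c, A.bracket_swap d, ContMDiffSection.coe_neg, ContMDiffSection.coe_neg,
    Pi.neg_apply, Pi.neg_apply, A.bracket_congr a hc]

/-- The anchor is a homomorphism for the action on functions. -/
theorem LieAlgebroid.deriv_bracket (a c : A.Sections) (g : C^∞⟮𝓡 m, M; ℝ⟯) :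
    (A.anchorSection (A.bracket a c)).deriv g =
      (A.anchorSection a).deriv ((A.anchorSection c).deriv g) -
        (A.anchorSection c).deriv ((A.anchorSection a).deriv g) := by
  ext y
  by_cases hF : ∃ v : A.Fiber y, v ≠ 0
  · obtain ⟨v, hv⟩ := hF
    obtain ⟨s, rfl⟩ := A.exists_section_eq v
    -- Expanding Jacobi for a, c, g s by Leibniz and subtracting g times Jacobi for a, c, s leaves
    -- (ρ[a, c] − [ρ(a), ρ(c)])(g) s = 0, where s y ≠ 0.
    have h := congrArg (fun t => t y) (A.jacobi a c (A.smulSection g s))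
    simp only [A.bracket_smulSection, map_add, ContMDiffSection.coe_add, Pi.add_apply,
      SmoothVectorBundle.smulSection_apply] at h
    have h' := congrArg (fun t => t y) (A.jacobi a c s)
    simp only [ContMDiffSection.coe_add, Pi.add_apply] at h'
    rw [h'] at h
    have h2 : ((A.anchorSection (A.bracket a c)).deriv g y -
      ((A.anchorSection a).deriv ((A.anchorSection c).deriv g) y -
        (A.anchorSection c).deriv ((A.anchorSection a).deriv g) y)) • s y = 0 := by
      rw [← sub_eq_zero] at h
      rw [← neg_eq_zero, ← h]
      module
    exact sub_eq_zero.1 ((smul_eq_zero.1 h2).resolve_right hv)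
  -- If the fibre at y is zero, all anchored vectors at y vanish and both sides are zero.
  · push Not at hF
    simp [VField.deriv_apply, A.anchorSection_apply, hF]

end Algebroid

/-! ### The tangent bundle as a Lie algebroid -/

section Tangent

variable {m : ℕ} {M : Type uM} [TopologicalSpace M] [ChartedSpace (EuclideanSpace ℝ (Fin m)) M]
  [IsManifold (𝓡 m) ∞ M]

theorem isManifold_minSmoothness (m : ℕ) (M : Type*) [TopologicalSpace M]
    [ChartedSpace (EuclideanSpace ℝ (Fin m)) M] [IsManifold (𝓡 m) ∞ M] :
    IsManifold (𝓡 m) (minSmoothness ℝ 3) M :=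
  IsManifold.of_le (n := ∞) (by
    simpa using (WithTop.coe_le_coe.2 le_top : ((3 : ℕ∞) : WithTop ℕ∞) ≤ ((⊤ : ℕ∞) : WithTop ℕ∞)))

/-- The tangent bundle as a Lie algebroid. -/
def tangentAlgebroid (m : ℕ) (M : Type uM) [TopologicalSpace M]
    [ChartedSpace (EuclideanSpace ℝ (Fin m)) M] [IsManifold (𝓡 m) ∞ M] :
    LieAlgebroid.{uM, 0} m M where
  rank := m
  Fiber := (TangentSpace (𝓡 m) : M → Type)
  anchor x := LinearMap.id
  contMDiff_anchor := contMDiff_id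
  bracket := LinearMap.mk₂ ℝ (fun X Y : VField m M => VField.bracket X Y)
    (fun X X' Y => by
      have := isManifold_minSmoothness m M
      ext x
      exact VectorField.mlieBracket_add_left X.mdifferentiableAt X'.mdifferentiableAt)
    (fun c X Y => by
      have := isManifold_minSmoothness m M
      ext x
      exact VectorField.mlieBracket_const_smul_left X.mdifferentiableAt)
    (fun X Y Y' => by
      have := isManifold_minSmoothness m M
      ext x
      exact VectorField.mlieBracket_add_right Y.mdifferentiableAt Y'.mdifferentiableAt)
    (fun c X Y => by
      have := isManifold_minSmoothness m M
      ext x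
      exact VectorField.mlieBracket_const_smul_right Y.mdifferentiableAt)
  bracket_self X := by
    ext x
    exact congrFun (VectorField.mlieBracket_self (V := X)) x
  jacobi X Y Z := by
    have := isManifold_minSmoothness m M
    have h : minSmoothness ℝ 2 ≤ ∞ := by
      simpa using (WithTop.coe_le_coe.2 le_top :
        ((2 : ℕ∞) : WithTop ℕ∞) ≤ ((⊤ : ℕ∞) : WithTop ℕ∞))
    ext x
    exact VectorField.leibniz_identity_mlieBracket_apply (X.contMDiff.contMDiffAt.of_le h)
      (Y.contMDiff.contMDiffAt.of_le h) (Z.contMDiff.contMDiffAt.of_le h)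
  leibniz X Y g x := VectorField.mlieBracket_smul_right (g.mdiffAt x) Y.mdifferentiableAt

/-- The Lie bracket of vector fields acts on functions as a commutator. -/
theorem VField.deriv_bracket [T2Space M] (X Y : VField m M) (g : C^∞⟮𝓡 m, M; ℝ⟯) :
    (VField.bracket X Y).deriv g = X.deriv (Y.deriv g) - Y.deriv (X.deriv g) :=
  -- The anchor of the tangent algebroid is the identity, so the statement is an instance of the
  -- general one.
  (tangentAlgebroid m M).deriv_bracket X Y g

end Tangent

open scoped TensorProduct

set_option linter.unusedSectionVars false

/-! ### Formal combinations C^∞(B) ⊗ Γ(A) -/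

section Tensor

variable {b : ℕ} {B : Type uB} [TopologicalSpace B]
  [ChartedSpace (EuclideanSpace ℝ (Fin b)) B] [IsManifold (𝓡 b) ∞ B]
  {m : ℕ} {M : Type uM} [TopologicalSpace M]
  [ChartedSpace (EuclideanSpace ℝ (Fin m)) M] [IsManifold (𝓡 m) ∞ M]
  (f : B → M) (A : LieAlgebroid.{uM, v} m M)

theorem SmoothVectorBundle.sum_apply (A : SmoothVectorBundle.{uM, v} m M) {ι : Type*}
    (t : Finset ι) (s : ι → A.Sections) (x : M) : (∑ i ∈ t, s i) x = ∑ i ∈ t, s i x := by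
  have h := ContMDiffSection.coeAddHom_apply (𝕜 := ℝ) (I := 𝓡 m)
    (F := EuclideanSpace ℝ (Fin A.rank)) (n := ∞) (V := A.Fiber) (∑ i ∈ t, s i)
  rw [← h, map_sum, Finset.sum_apply]
  rfl

/-- Formal combinations of sections of `A` with coefficients in `C^∞(B)`. -/
abbrev FormalSections (b : ℕ) (B : Type uB) [TopologicalSpace B]
    [ChartedSpace (EuclideanSpace ℝ (Fin b)) B] (A : LieAlgebroid.{uM, v} m M) :=
  C^∞⟮𝓡 b, B; ℝ⟯ ⊗[ℝ] A.Sections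

/-- The value at `x` of the section of `f^*A` defined by a formal combination. -/
def formalEval (x : B) : FormalSections b B A →ₗ[ℝ] A.Fiber (f x) :=
  TensorProduct.lift (LinearMap.mk₂ ℝ (fun (h : C^∞⟮𝓡 b, B; ℝ⟯) (a : A.Sections) => h x • a (f x))
    (fun h h' a => add_smul _ _ _) (fun c h a => by
      rw [ContMDiffMap.coe_smul, Pi.smul_apply, smul_assoc])
    (fun h a a' => by rw [ContMDiffSection.coe_add, Pi.add_apply, smul_add])
    (fun c h a => by rw [ContMDiffSection.coe_smul, Pi.smul_apply, smul_comm]))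

@[simp] theorem formalEval_tmul (x : B) (h : C^∞⟮𝓡 b, B; ℝ⟯) (a : A.Sections) :
    formalEval f A x (h ⊗ₜ a) = h x • a (f x) := rfl

/-- The `C^∞(B)`-bilinear extension of the bracket of `A`. -/
def formalBracket : FormalSections b B A →ₗ[ℝ] FormalSections b B A →ₗ[ℝ] FormalSections b B A :=
  TensorProduct.map₂ (LinearMap.mul ℝ _) A.bracket

@[simp] theorem formalBracket_tmul (h h' : C^∞⟮𝓡 b, B; ℝ⟯) (a a' : A.Sections) :
    formalBracket A (h ⊗ₜ a) (h' ⊗ₜ a') = (h * h') ⊗ₜ A.bracket a a' := rfl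

/-- The derivative of the coefficients along a vector field. -/
def formalDeriv (X : VField b B) : FormalSections b B A →ₗ[ℝ] FormalSections b B A :=
  LinearMap.rTensor _ X.deriv

@[simp] theorem formalDeriv_tmul (X : VField b B) (h : C^∞⟮𝓡 b, B; ℝ⟯) (a : A.Sections) :
    formalDeriv A X (h ⊗ₜ a) = X.deriv h ⊗ₜ a := rfl

/-- Multiplication of the coefficients by a function. -/
def formalSmul (g : C^∞⟮𝓡 b, B; ℝ⟯) : FormalSections b B A →ₗ[ℝ] FormalSections b B A :=
  LinearMap.rTensor _ (LinearMap.mulLeft ℝ g)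

@[simp] theorem formalSmul_tmul (g h : C^∞⟮𝓡 b, B; ℝ⟯) (a : A.Sections) :
    formalSmul A g (h ⊗ₜ a) = (g * h) ⊗ₜ a := rfl

/-- The first component of the bracket of `(ξ, X)` and `(η, Y)`. -/
def pairBracket (X Y : VField b B) (ξ η : FormalSections b B A) : FormalSections b B A :=
  formalBracket A ξ η + formalDeriv A X η - formalDeriv A Y ξ

variable {A}

theorem formalBracket_swap (ξ η : FormalSections b B A) :
    formalBracket A ξ η = -formalBracket A η ξ := by
  induction ξ using TensorProduct.induction_on with
  | zero => simp
  | add ξ ξ' h h' => simp only [map_add, LinearMap.add_apply, h, h', neg_add]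
  | tmul h a =>
    induction η using TensorProduct.induction_on with
    | zero => simp
    | add η η' h h' => simp only [map_add, LinearMap.add_apply, h, h', neg_add]
    | tmul h' a' =>
      rw [formalBracket_tmul, formalBracket_tmul, A.bracket_swap, mul_comm, TensorProduct.tmul_neg]

/-- A commutative algebra tensored with a Lie algebra is a Lie algebra. -/
theorem formalBracket_jacobi (ξ η ζ : FormalSections b B A) :
    formalBracket A ξ (formalBracket A η ζ) =
      formalBracket A (formalBracket A ξ η) ζ + formalBracket A η (formalBracket A ξ ζ) := by
  induction ξ using TensorProduct.induction_on with
  | zero => simp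
  | add ξ ξ' h h' => simp only [map_add, LinearMap.add_apply, h, h']; abel
  | tmul h a =>
    induction η using TensorProduct.induction_on with
    | zero => simp
    | add η η' h h' => simp only [map_add, LinearMap.add_apply, h, h']; abel
    | tmul h' a' =>
      induction ζ using TensorProduct.induction_on with
      | zero => simp
      | add ζ ζ' h h' => simp only [map_add, h, h']; abel
      | tmul h'' a'' =>
        simp only [formalBracket_tmul]
        rw [A.jacobi, TensorProduct.tmul_add]
        congr 2 <;> ring

theorem formalDeriv_formalBracket (X : VField b B) (ξ η : FormalSections b B A) :
    formalDeriv A X (formalBracket A ξ η) =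
      formalBracket A (formalDeriv A X ξ) η + formalBracket A ξ (formalDeriv A X η) := by
  induction ξ using TensorProduct.induction_on with
  | zero => simp
  | add ξ ξ' h h' => simp only [map_add, LinearMap.add_apply, h, h']; abel
  | tmul h a =>
    induction η using TensorProduct.induction_on with
    | zero => simp
    | add η η' h h' => simp only [map_add, h, h']; abel
    | tmul h' a' =>
      simp only [formalBracket_tmul, formalDeriv_tmul]
      rw [X.deriv_mul, add_comm, TensorProduct.add_tmul, mul_comm h']

theorem formalDeriv_bracket [T2Space B] (X Y : VField b B) (ξ : FormalSections b B A) :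
    formalDeriv A (VField.bracket X Y) ξ =
      formalDeriv A X (formalDeriv A Y ξ) - formalDeriv A Y (formalDeriv A X ξ) := by
  induction ξ using TensorProduct.induction_on with
  | zero => simp
  | add ξ ξ' h h' => simp only [map_add, h, h']; abel
  | tmul h a =>
    simp only [formalDeriv_tmul]
    rw [VField.deriv_bracket, TensorProduct.sub_tmul]

/-- Vector fields on B act on the Lie algebra C^∞(B) ⊗ Γ(A) through the coefficients, by
derivations, and the action respects brackets. The pair bracket is that of the semidirect product,
so no relation between ξ and X is needed. -/
theorem pairBracket_jacobi [T2Space B] (X Y Z : VField b B) (ξ η ζ : FormalSections b B A) :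
    pairBracket A X (VField.bracket Y Z) ξ (pairBracket A Y Z η ζ) =
      pairBracket A (VField.bracket X Y) Z (pairBracket A X Y ξ η) ζ +
      pairBracket A Y (VField.bracket X Z) η (pairBracket A X Z ξ ζ) := by
  simp only [pairBracket, map_add, map_sub, LinearMap.add_apply, LinearMap.sub_apply,
    formalDeriv_formalBracket, formalDeriv_bracket]
  rw [formalBracket_jacobi ξ η ζ, formalBracket_swap η (formalDeriv A Z ξ)]
  abel

theorem pairBracket_self (X : VField b B) (ξ : FormalSections b B A) :
    pairBracket A X X ξ ξ = 0 := by
  have h := formalBracket_swap ξ ξ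
  have h' : (2 : ℝ) • formalBracket A ξ ξ = 0 := by
    rw [two_smul]
    nth_rewrite 1 [h]
    exact neg_add_cancel _
  rw [pairBracket, (smul_eq_zero.1 h').resolve_left two_ne_zero]
  simp

theorem formalBracket_formalSmul (g : C^∞⟮𝓡 b, B; ℝ⟯) (ξ η : FormalSections b B A) :
    formalBracket A ξ (formalSmul A g η) = formalSmul A g (formalBracket A ξ η) := by
  induction ξ using TensorProduct.induction_on with
  | zero => simp
  | add ξ ξ' h h' => simp only [map_add, LinearMap.add_apply, h, h']
  | tmul h a =>
    induction η using TensorProduct.induction_on with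
    | zero => simp
    | add η η' h h' => simp only [map_add, h, h']
    | tmul h' a' =>
      simp only [formalBracket_tmul, formalSmul_tmul]
      congr 1
      ring

theorem formalDeriv_formalSmul (X : VField b B) (g : C^∞⟮𝓡 b, B; ℝ⟯) (η : FormalSections b B A) :
    formalDeriv A X (formalSmul A g η) =
      formalSmul A (X.deriv g) η + formalSmul A g (formalDeriv A X η) := by
  induction η using TensorProduct.induction_on with
  | zero => simp
  | add η η' h h' => simp only [map_add, h, h']; abel
  | tmul h' a' =>
    simp only [formalDeriv_tmul, formalSmul_tmul]
    rw [X.deriv_mul, add_comm, TensorProduct.add_tmul, mul_comm h']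

theorem formalEval_formalSmul (x : B) (g : C^∞⟮𝓡 b, B; ℝ⟯) (η : FormalSections b B A) :
    formalEval f A x (formalSmul A g η) = g x • formalEval f A x η := by
  induction η using TensorProduct.induction_on with
  | zero => simp
  | add η η' h h' => simp only [map_add, h, h', smul_add]
  | tmul h' a' =>
    simp only [formalSmul_tmul, formalEval_tmul, ContMDiffMap.coe_mul, Pi.mul_apply, mul_smul]

variable {f}

theorem smoothAlong_formalEval (hf : ContMDiff (𝓡 b) (𝓡 m) ∞ f) (ξ : FormalSections b B A) :
    A.SmoothAlong (b := b) f fun x => formalEval f A x ξ := by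
  intro x
  induction ξ using TensorProduct.induction_on with
  | zero => exact contMDiffWithinAt_zero_along (hf x)
  | add ξ ξ' h h' =>
    simp only [map_add]
    exact contMDiffWithinAt_add_along h h'
  | tmul h a =>
    exact contMDiffWithinAt_smul_along h.contMDiff.contMDiffAt ((a.contMDiff.comp hf) x)

/-- Functions on `M` pulled back to `B`. -/
def pullFun (hf : ContMDiff (𝓡 b) (𝓡 m) ∞ f) : C^∞⟮𝓡 m, M; ℝ⟯ →ₗ[ℝ] C^∞⟮𝓡 b, B; ℝ⟯ where
  toFun g := ⟨fun x => g (f x), g.contMDiff.comp hf⟩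
  map_add' _ _ := rfl
  map_smul' _ _ := rfl

theorem pullFun_apply (hf : ContMDiff (𝓡 b) (𝓡 m) ∞ f) (g : C^∞⟮𝓡 m, M; ℝ⟯) (x : B) :
    pullFun hf g x = g (f x) := rfl

theorem VField.deriv_pullFun (hf : ContMDiff (𝓡 b) (𝓡 m) ∞ f) (X : VField b B)
    (g : C^∞⟮𝓡 m, M; ℝ⟯) (x : B) :
    X.deriv (pullFun hf g) x = dirDeriv g (f x) (mfderiv (𝓡 b) (𝓡 m) f x (X x)) :=
  dirDeriv_comp hf g x (X x)

variable (A)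

/-- The action of the sections of `A` on functions. -/
def LieAlgebroid.act : A.Sections →ₗ[ℝ] C^∞⟮𝓡 m, M; ℝ⟯ →ₗ[ℝ] C^∞⟮𝓡 m, M; ℝ⟯ where
  toFun a := (A.anchorSection a).deriv
  map_add' a a' := by
    ext g x
    change dirDeriv g x (A.anchor x (a x + a' x)) = _
    rw [map_add, dirDeriv_add_right]
    rfl
  map_smul' c a := by
    ext g x
    change dirDeriv g x (A.anchor x (c • a x)) = _
    rw [map_smul, dirDeriv_smul_right]
    rfl

/-- The product of a function on `B` with the pullback of a function on `M`. -/
def pullMul (hf : ContMDiff (𝓡 b) (𝓡 m) ∞ f) :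
    C^∞⟮𝓡 b, B; ℝ⟯ ⊗[ℝ] C^∞⟮𝓡 m, M; ℝ⟯ →ₗ[ℝ] C^∞⟮𝓡 b, B; ℝ⟯ :=
  TensorProduct.lift ((LinearMap.mul ℝ _).compl₂ (pullFun hf))

/-- The derivative of `g` along `ρ(ξ)`. -/
def formalAct (hf : ContMDiff (𝓡 b) (𝓡 m) ∞ f) (g : C^∞⟮𝓡 m, M; ℝ⟯) :
    FormalSections b B A →ₗ[ℝ] C^∞⟮𝓡 b, B; ℝ⟯ :=
  pullMul hf ∘ₗ LinearMap.lTensor _ (A.act.flip g)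

/-- The `C^∞(B)`-bilinear extension of the second derivative `ρ(a) ρ(a') g`. -/
def formalAct₂ (hf : ContMDiff (𝓡 b) (𝓡 m) ∞ f) (g : C^∞⟮𝓡 m, M; ℝ⟯) :
    FormalSections b B A →ₗ[ℝ] FormalSections b B A →ₗ[ℝ] C^∞⟮𝓡 b, B; ℝ⟯ :=
  (TensorProduct.map₂ (LinearMap.mul ℝ _) (A.act.compl₂ (A.act.flip g))).compr₂ (pullMul hf)

variable {A}

theorem formalAct_tmul (hf : ContMDiff (𝓡 b) (𝓡 m) ∞ f) (g : C^∞⟮𝓡 m, M; ℝ⟯)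
    (h : C^∞⟮𝓡 b, B; ℝ⟯) (a : A.Sections) :
    formalAct A hf g (h ⊗ₜ a) = h * pullFun hf (A.act a g) := rfl

theorem formalAct₂_tmul (hf : ContMDiff (𝓡 b) (𝓡 m) ∞ f) (g : C^∞⟮𝓡 m, M; ℝ⟯)
    (h h' : C^∞⟮𝓡 b, B; ℝ⟯) (a a' : A.Sections) :
    formalAct₂ A hf g (h ⊗ₜ a) (h' ⊗ₜ a') = h * h' * pullFun hf (A.act a (A.act a' g)) := rfl

theorem formalAct₂_tmul_right (hf : ContMDiff (𝓡 b) (𝓡 m) ∞ f) (g : C^∞⟮𝓡 m, M; ℝ⟯)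
    (ξ : FormalSections b B A) (h' : C^∞⟮𝓡 b, B; ℝ⟯) (a' : A.Sections) :
    formalAct₂ A hf g ξ (h' ⊗ₜ a') = h' * formalAct A hf (A.act a' g) ξ := by
  induction ξ using TensorProduct.induction_on with
  | zero => simp
  | add ξ ξ' h h' => simp only [map_add, LinearMap.add_apply, h, h', mul_add]
  | tmul h a =>
    rw [formalAct₂_tmul, formalAct_tmul]
    ring

/-- Shows that `formalAct` has the intended values ρ(ξ)(g); being a smooth function on B, it can be
differentiated again. -/
theorem dirDeriv_anchor_formalEval (hf : ContMDiff (𝓡 b) (𝓡 m) ∞ f) (g : C^∞⟮𝓡 m, M; ℝ⟯)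
    (x : B) (ξ : FormalSections b B A) :
    dirDeriv g (f x) (A.anchor (f x) (formalEval f A x ξ)) = formalAct A hf g ξ x := by
  induction ξ using TensorProduct.induction_on with
  | zero => simp
  | add ξ ξ' h h' => simp only [map_add, dirDeriv_add_right, h, h']; rfl
  | tmul h a =>
    rw [formalEval_tmul, map_smul, dirDeriv_smul_right, formalAct_tmul]
    rfl

/-- Product rule for h · (ρ(a)g ∘ f): X differentiates either the coefficient h or the pulled back
function, the latter along f_*X = ρ(ξ), which yields the second derivative. -/
theorem dirDeriv_formalAct (hf : ContMDiff (𝓡 b) (𝓡 m) ∞ f) (g : C^∞⟮𝓡 m, M; ℝ⟯) (X : VField b B)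
    (x : B) {ξ : FormalSections b B A}
    (hξ : A.anchor (f x) (formalEval f A x ξ) = mfderiv (𝓡 b) (𝓡 m) f x (X x))
    (η : FormalSections b B A) :
    X.deriv (formalAct A hf g η) x =
      formalAct A hf g (formalDeriv A X η) x + formalAct₂ A hf g ξ η x := by
  induction η using TensorProduct.induction_on with
  | zero => simp
  | add η η' h h' =>
    simp only [map_add, ContMDiffMap.coe_add, Pi.add_apply, h, h']
    ring
  | tmul h a =>
    rw [formalAct_tmul, X.deriv_mul, formalDeriv_tmul, formalAct_tmul, formalAct₂_tmul_right]
    simp only [ContMDiffMap.coe_add, ContMDiffMap.coe_mul, Pi.add_apply, Pi.mul_apply]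
    have h1 : X.deriv (pullFun hf (A.act a g)) x = formalAct A hf (A.act a g) ξ x := by
      rw [← dirDeriv_anchor_formalEval, hξ, VField.deriv_pullFun]
    rw [h1]
    ring

/-- The coefficientwise form of ρ[a, a'] = [ρ(a), ρ(a')], as given by `LieAlgebroid.deriv_bracket`.
-/
theorem formalAct_formalBracket [T2Space M] (hf : ContMDiff (𝓡 b) (𝓡 m) ∞ f)
    (g : C^∞⟮𝓡 m, M; ℝ⟯) (ξ η : FormalSections b B A) :
    formalAct A hf g (formalBracket A ξ η) =
      formalAct₂ A hf g ξ η - formalAct₂ A hf g η ξ := by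
  induction ξ using TensorProduct.induction_on with
  | zero => simp
  | add ξ ξ' h h' => simp only [map_add, LinearMap.add_apply, h, h']; abel
  | tmul h a =>
    induction η using TensorProduct.induction_on with
    | zero => simp
    | add η η' h h' => simp only [map_add, LinearMap.add_apply, h, h']; abel
    | tmul h' a' =>
      rw [formalBracket_tmul, formalAct_tmul, formalAct₂_tmul, formalAct₂_tmul,
        show A.act (A.bracket a a') g = A.act a (A.act a' g) - A.act a' (A.act a g) from
          A.deriv_bracket a a' g, map_sub]
      ring

/-- The bracket of two pairs in `f^!A` is again in `f^!A`. -/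
theorem anchor_pairBracket [T2Space B] [T2Space M] (hf : ContMDiff (𝓡 b) (𝓡 m) ∞ f)
    {X Y : VField b B} {ξ η : FormalSections b B A} {x : B}
    (hξ : ∀ᶠ y in 𝓝 x, A.anchor (f y) (formalEval f A y ξ) = mfderiv (𝓡 b) (𝓡 m) f y (X y))
    (hη : ∀ᶠ y in 𝓝 x, A.anchor (f y) (formalEval f A y η) = mfderiv (𝓡 b) (𝓡 m) f y (Y y)) :
    A.anchor (f x) (formalEval f A x (pairBracket A X Y ξ η)) =
      mfderiv (𝓡 b) (𝓡 m) f x (VField.bracket X Y x) := by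
  -- On a function g of M, f_*[X, Y] acts as X(Y(g ∘ f)) − Y(X(g ∘ f)). Here Y(g ∘ f) = ρ(η)g and
  -- X(g ∘ f) = ρ(ξ)g near x, and they are differentiated once more; hence the hypotheses on a
  -- neighbourhood.
  refine eq_of_dirDeriv_eq fun g => ?_
  have key : ∀ {X : VField b B} {ξ : FormalSections b B A}, (∀ᶠ y in 𝓝 x, A.anchor (f y)
      (formalEval f A y ξ) = mfderiv (𝓡 b) (𝓡 m) f y (X y)) →
      ∀ᶠ y in 𝓝 x, X.deriv (pullFun hf g) y = formalAct A hf g ξ y := by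
    intro X ξ h
    filter_upwards [h] with y hy
    rw [← dirDeriv_anchor_formalEval, hy, VField.deriv_pullFun]
  rw [dirDeriv_anchor_formalEval hf, ← VField.deriv_pullFun hf, VField.deriv_bracket,
    ContMDiffMap.coe_sub, Pi.sub_apply]
  have h1 : X.deriv (Y.deriv (pullFun hf g)) x = X.deriv (formalAct A hf g η) x :=
    dirDeriv_congr (key hη) _
  have h2 : Y.deriv (X.deriv (pullFun hf g)) x = Y.deriv (formalAct A hf g ξ) x :=
    dirDeriv_congr (key hξ) _
  rw [h1, h2, dirDeriv_formalAct hf g X x hξ.self_of_nhds,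
    dirDeriv_formalAct hf g Y x hη.self_of_nhds, pairBracket, map_sub, map_add,
    formalAct_formalBracket]
  simp only [ContMDiffMap.coe_sub, ContMDiffMap.coe_add, Pi.sub_apply, Pi.add_apply]
  ring

end Tensor

/-! ### Independence of the formal representatives -/

section WellDefined

variable {b : ℕ} {B : Type uB} [TopologicalSpace B]
  [ChartedSpace (EuclideanSpace ℝ (Fin b)) B] [IsManifold (𝓡 b) ∞ B]
  {m : ℕ} {M : Type uM} [TopologicalSpace M]
  [ChartedSpace (EuclideanSpace ℝ (Fin m)) M] [IsManifold (𝓡 m) ∞ M]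
  {f : B → M} {A : LieAlgebroid.{uM, v} m M}

theorem formalEval_formalBracket_tmul (x : B) (h : C^∞⟮𝓡 b, B; ℝ⟯) (a : A.Sections)
    (η : FormalSections b B A) :
    formalEval f A x (formalBracket A (h ⊗ₜ a) η) =
      h x • formalEval f A x (formalBracket A (1 ⊗ₜ a) η) := by
  induction η using TensorProduct.induction_on with
  | zero => simp
  | add η η' h h' => simp only [map_add, h, h', smul_add]
  | tmul h' a' =>
    simp only [formalBracket_tmul, formalEval_tmul, ContMDiffMap.coe_mul, Pi.mul_apply, mul_smul,
      one_mul]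

variable [T2Space M]

/-- The Leibniz rule in the first argument, for each section occurring in η; the derivatives of the
coefficients add up to derivatives along ρ(η). -/
theorem formalEval_bracket_of_eventually_eq_sum (x : B) {ι : Type*} [Fintype ι] {a : A.Sections}
    {c : ι → C^∞⟮𝓡 m, M; ℝ⟯} {e : ι → A.Sections}
    (ha : ∀ᶠ y in 𝓝 (f x), a y = ∑ i, c i y • e i y) (η : FormalSections b B A) :
    formalEval f A x (formalBracket A (1 ⊗ₜ a) η) =
      ∑ i, (c i (f x) • formalEval f A x (formalBracket A (1 ⊗ₜ e i) η) -
        dirDeriv (c i) (f x) (A.anchor (f x) (formalEval f A x η)) • e i (f x)) := by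
  induction η using TensorProduct.induction_on with
  | zero => simp
  | add η η' h h' =>
    simp only [map_add, h, h', ← Finset.sum_add_distrib, dirDeriv_add_right]
    refine Finset.sum_congr rfl fun i _ => ?_
    module
  | tmul h' a' =>
    have h1 : A.bracket a a' (f x) = A.bracket (∑ i, A.smulSection (c i) (e i)) a' (f x) :=
      A.bracket_congr_left a' (by
        filter_upwards [ha] with y hy
        rw [hy, SmoothVectorBundle.sum_apply]
        rfl)
    simp only [formalBracket_tmul, formalEval_tmul, one_mul, map_smul, dirDeriv_smul_right]
    rw [h1, map_sum, LinearMap.sum_apply, SmoothVectorBundle.sum_apply, Finset.smul_sum]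
    refine Finset.sum_congr rfl fun i _ => ?_
    rw [A.leibniz_left]
    module

/-- For ξ = h ⊗ a with a = ∑ c_i e_i near f x, replace ξ by ∑ h (c_i ∘ f) ⊗ e_i. The original
bracket has extra terms −h ρ(η)(c_i) e_i from Leibniz, the new expression −h Y(c_i ∘ f) e_i from the
coefficients; `hη` makes them equal, as Y(c_i ∘ f) = (f_*Y)(c_i). -/
theorem exists_frame_presentation [T2Space B] (hf : ContMDiff (𝓡 b) (𝓡 m) ∞ f) (Y : VField b B)
    {x : B} {η : FormalSections b B A}
    (hη : A.anchor (f x) (formalEval f A x η) = mfderiv (𝓡 b) (𝓡 m) f x (Y x))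
    {e : Fin A.rank → A.Sections} (he : ∀ᶠ y in 𝓝 (f x), y ∈ A.chartSet (f x) ∧
      ∀ i, e i y = A.frame (f x) i y) (ξ : FormalSections b B A) :
    ∃ g : Fin A.rank → C^∞⟮𝓡 b, B; ℝ⟯,
      (∀ᶠ y in 𝓝 x, formalEval f A y ξ = ∑ i, g i y • e i (f y)) ∧
      formalEval f A x (formalBracket A ξ η - formalDeriv A Y ξ) =
        formalEval f A x (formalBracket A (∑ i, g i ⊗ₜ e i) η -
          formalDeriv A Y (∑ i, g i ⊗ₜ e i)) := by
  induction ξ using TensorProduct.induction_on with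
  | zero => exact ⟨0, by simp, by simp⟩
  | add ξ ξ' h h' =>
    obtain ⟨g, hg, h1⟩ := h
    obtain ⟨g', hg', h1'⟩ := h'
    refine ⟨g + g', ?_, ?_⟩
    · filter_upwards [hg, hg'] with y hy hy'
      simp only [map_add, hy, hy', Pi.add_apply, ContMDiffMap.coe_add, add_smul,
        Finset.sum_add_distrib]
    · simp only [map_sub, map_add, LinearMap.add_apply, Pi.add_apply, TensorProduct.add_tmul,
        Finset.sum_add_distrib] at h1 h1' ⊢
      rw [add_sub_add_comm, h1, h1', add_sub_add_comm]
  | tmul h a =>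
    obtain ⟨c, -, hc⟩ := SmoothVectorBundle.SmoothAlong.exists_coef (b := m)
      (A := A.toSmoothVectorBundle) (f := id) continuous_id (σ := fun y => a y) a.contMDiff (f x)
    have hc' : ∀ᶠ y in 𝓝 (f x), a y = ∑ i, c i y • e i y := by
      filter_upwards [hc, he] with y h1 h2
      simp only [h2.2]
      exact h1
    refine ⟨fun i => h * pullFun hf (c i), ?_, ?_⟩
    · filter_upwards [hf.continuous.continuousAt.eventually hc'] with y hy
      rw [formalEval_tmul, hy, Finset.smul_sum]
      refine Finset.sum_congr rfl fun i _ => ?_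
      rw [ContMDiffMap.coe_mul, Pi.mul_apply, mul_smul]
      rfl
    · simp only [map_sub, map_sum, LinearMap.sum_apply]
      rw [formalEval_formalBracket_tmul, formalEval_bracket_of_eventually_eq_sum x hc' η,
        formalDeriv_tmul, formalEval_tmul, hc'.self_of_nhds, Finset.smul_sum, Finset.smul_sum,
        ← Finset.sum_sub_distrib, ← Finset.sum_sub_distrib]
      refine Finset.sum_congr rfl fun i _ => ?_
      rw [formalEval_formalBracket_tmul x (h * pullFun hf (c i)), formalDeriv_tmul,
        formalEval_tmul, hη, Y.deriv_mul]
      simp only [ContMDiffMap.coe_mul, ContMDiffMap.coe_add, Pi.mul_apply, Pi.add_apply,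
        VField.deriv_pullFun, pullFun_apply]
      module

/-- The bracket of a formal combination which represents zero vanishes. -/
theorem formalEval_eq_zero [T2Space B] (hf : ContMDiff (𝓡 b) (𝓡 m) ∞ f) (Y : VField b B)
    {x : B} {ξ η : FormalSections b B A} (hξ : ∀ᶠ y in 𝓝 x, formalEval f A y ξ = 0)
    (hη : A.anchor (f x) (formalEval f A x η) = mfderiv (𝓡 b) (𝓡 m) f x (Y x)) :
    formalEval f A x (formalBracket A ξ η - formalDeriv A Y ξ) = 0 := by
  obtain ⟨e, -, he⟩ := A.exists_global_frame (f x)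
  obtain ⟨g, hg, h1⟩ := exists_frame_presentation hf Y hη he ξ
  -- By independence of the frame the coefficients vanish near x, so their derivatives along Y
  -- vanish at x too.
  have hg0 : ∀ᶠ y in 𝓝 x, ∀ i, g i y = 0 := by
    filter_upwards [hg, hξ, hf.continuous.continuousAt.eventually he] with y h2 h3 h4
    refine A.eq_zero_of_sum_frame (f x) h4.1 (c := fun i => g i y) ?_
    simp only [← h4.2, ← h2, h3]
  rw [h1]
  simp only [map_sub, map_sum, LinearMap.sum_apply, ← Finset.sum_sub_distrib]
  refine Finset.sum_eq_zero fun i _ => ?_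
  have h5 : Y.deriv (g i) x = 0 :=
    (dirDeriv_congr (h := fun _ => 0) (hg0.mono fun y hy => hy i) (Y x)).trans
      (dirDeriv_const 0 x _)
  rw [formalEval_formalBracket_tmul, formalDeriv_tmul, formalEval_tmul, h5, hg0.self_of_nhds i]
  simp

/-- The bracket does not depend on the formal combinations which represent the sections. -/
theorem formalEval_pairBracket_congr [T2Space B] (hf : ContMDiff (𝓡 b) (𝓡 m) ∞ f)
    {X Y : VField b B} {x : B} {ξ ξ' η η' : FormalSections b B A}
    (hξ : ∀ᶠ y in 𝓝 x, formalEval f A y ξ = formalEval f A y ξ')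
    (hη : ∀ᶠ y in 𝓝 x, formalEval f A y η = formalEval f A y η')
    (hX : A.anchor (f x) (formalEval f A x ξ) = mfderiv (𝓡 b) (𝓡 m) f x (X x))
    (hY : A.anchor (f x) (formalEval f A x η) = mfderiv (𝓡 b) (𝓡 m) f x (Y x)) :
    formalEval f A x (pairBracket A X Y ξ η) = formalEval f A x (pairBracket A X Y ξ' η') := by
  rw [hξ.self_of_nhds] at hX
  have h1 := formalEval_eq_zero hf Y (ξ := ξ - ξ') (η := η) (x := x)
    (hξ.mono fun y hy => by rw [map_sub, hy, sub_self]) hY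
  have h2 := formalEval_eq_zero hf X (ξ := η - η') (η := ξ') (x := x)
    (hη.mono fun y hy => by rw [map_sub, hy, sub_self]) hX
  rw [← sub_eq_zero, ← map_sub]
  -- One argument is replaced at a time: ξ − ξ' is paired with η, and η − η' with ξ', which still
  -- satisfies the anchor condition at x.
  have h3 : pairBracket A X Y ξ η - pairBracket A X Y ξ' η' =
      (formalBracket A (ξ - ξ') η - formalDeriv A Y (ξ - ξ')) -
      (formalBracket A (η - η') ξ' - formalDeriv A X (η - η')) := by
    rw [formalBracket_swap (η - η') ξ']
    simp only [pairBracket, map_sub, LinearMap.sub_apply]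
    abel
  rw [h3, map_sub, h1, h2, sub_zero]

end WellDefined

/-! ### Sections of f^!A and their bracket -/

section Sections

variable {b : ℕ} {B : Type uB} [TopologicalSpace B]
  [ChartedSpace (EuclideanSpace ℝ (Fin b)) B] [IsManifold (𝓡 b) ∞ B]
  {m : ℕ} {M : Type uM} [TopologicalSpace M]
  [ChartedSpace (EuclideanSpace ℝ (Fin m)) M] [IsManifold (𝓡 m) ∞ M]
  {f : B → M} {A : LieAlgebroid.{uM, v} m M} (P : PullbackBundle.{uB, uM, v, w} b f A)

theorem PullbackBundle.eq_of_proj_anchor {x : B} {v w : P.Fiber x} (h1 : P.proj x v = P.proj x w)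
    (h2 : P.anchor x v = P.anchor x w) : v = w :=
  (P.bijOn x).injOn (mem_univ v) (mem_univ w) (Prod.ext h1 h2)

/-- A section of `f^!A` is smooth if both of its components are. -/
theorem PullbackBundle.contMDiff_section (hf : ContMDiff (𝓡 b) (𝓡 m) ∞ f) {α : ∀ x, P.Fiber x}
    (h1 : A.SmoothAlong (b := b) f fun x => P.proj x (α x))
    (h2 : ContMDiff (𝓡 b) (𝓡 b).tangent ∞
      fun x => (⟨x, P.anchor x (α x)⟩ : TangentBundle (𝓡 b) B)) :
    ContMDiff (𝓡 b) ((𝓡 b).prod 𝓘(ℝ, EuclideanSpace ℝ (Fin P.rank))) ∞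
      fun x => (⟨x, α x⟩ : P.Total) := by
  intro x₀
  set U := P.chartSet x₀ ∩ sumSet b f A x₀
  have hU : IsOpen U := (trivializationAt _ P.Fiber x₀).open_baseSet.inter
    (isOpen_sumSet A hf.continuous x₀)
  have hx₀ : x₀ ∈ U := ⟨P.mem_chartSet x₀, mem_sumSet b f A x₀⟩
  let τ : ∀ x, P.Fiber x →ₗ[ℝ] sumModel A b := fun x =>
    sumCoord b f A x₀ x ∘ₗ (P.proj x).prod (P.anchor x)
  let w : Fin P.rank → B → sumModel A b := fun i x => τ x (P.frame x₀ i x)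
  let v : B → sumModel A b := fun x => sumCoord b f A x₀ x (P.proj x (α x), P.anchor x (α x))
  have hw : ∀ i, ContMDiffOn (𝓡 b) 𝓘(ℝ, sumModel A b) ∞ (w i) U := fun i =>
    contMDiffOn_sumCoord x₀ inter_subset_right
      (P.contMDiff_proj.comp_contMDiffOn ((P.contMDiffOn_frame x₀ i).mono inter_subset_left))
      (P.contMDiff_anchor.comp_contMDiffOn ((P.contMDiffOn_frame x₀ i).mono inter_subset_left))
  have hv : ContMDiffOn (𝓡 b) 𝓘(ℝ, sumModel A b) ∞ v U :=
    contMDiffOn_sumCoord x₀ inter_subset_right h1.contMDiffOn h2.contMDiffOn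
  -- S x embeds the frame coordinates of f^!A into those of f^*A ⊕ TB. It is injective at x₀, so a
  -- left inverse L of S x₀ makes L ∘ S x invertible nearby, and the frame coordinates of α are (L ∘
  -- S x)⁻¹ L (v x), which is smooth.
  let S : B → EuclideanSpace ℝ (Fin P.rank) →L[ℝ] sumModel A b := fun x =>
    ∑ i, (EuclideanSpace.proj (𝕜 := ℝ) i : EuclideanSpace ℝ (Fin P.rank) →L[ℝ] ℝ).smulRight (w i x)
  have hSapp : ∀ x c, S x c = ∑ i, c i • w i x := fun x c => by simp [S, sum_apply]
  have hS : ContMDiffOn (𝓡 b) 𝓘(ℝ, EuclideanSpace ℝ (Fin P.rank) →L[ℝ] sumModel A b) ∞ S U := by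
    refine contMDiffOn_clm_of_apply fun c => ?_
    simp only [hSapp]
    exact contMDiffOn_finsetSum fun i _ =>
      (c i • ContinuousLinearMap.id ℝ (sumModel A b)).contMDiff.comp_contMDiffOn (hw i)
  have hSsum : ∀ x c, S x c = τ x (∑ i, c i • P.frame x₀ i x) := by
    intro x c
    rw [hSapp, map_sum]
    simp only [w, map_smul]
  have hker : LinearMap.ker (S x₀).toLinearMap = ⊥ := by
    refine LinearMap.ker_eq_bot'.2 fun c hc => ?_
    have h3 : S x₀ c = 0 := hc
    rw [hSsum] at h3
    have h4 := congrArg (sumCoordSymm b f A x₀ x₀) h3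
    rw [map_zero] at h4
    replace h4 := (sumCoordSymm_sumCoord hx₀.2 _).symm.trans h4
    have h5 : ∑ i, c i • P.frame x₀ i x₀ = 0 := P.eq_of_proj_anchor
      ((congrArg Prod.fst h4).trans (map_zero _).symm)
      ((congrArg Prod.snd h4).trans (map_zero _).symm)
    ext i
    exact P.eq_zero_of_sum_frame x₀ hx₀.1 (c := fun i => c i) h5 i
  obtain ⟨l, hl⟩ := (S x₀).toLinearMap.exists_leftInverse_of_injective hker
  let L : sumModel A b →L[ℝ] EuclideanSpace ℝ (Fin P.rank) := LinearMap.toContinuousLinearMap l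
  have hLS : ContMDiffOn (𝓡 b) 𝓘(ℝ, EuclideanSpace ℝ (Fin P.rank) →L[ℝ]
      EuclideanSpace ℝ (Fin P.rank)) ∞ (fun x => L.comp (S x)) U := contMDiffOn_const.clm_comp hS
  have h0 : L.comp (S x₀) = 1 := by
    ext1 c
    exact LinearMap.congr_fun hl c
  set U' := U ∩ (fun x => L.comp (S x)) ⁻¹' {T | IsUnit T}
  have hU' : IsOpen U' := hLS.continuousOn.isOpen_inter_preimage hU Units.isOpen
  have hx₀' : x₀ ∈ U' := ⟨hx₀, by simp [h0]⟩
  have hc : ContMDiffOn (𝓡 b) 𝓘(ℝ, EuclideanSpace ℝ (Fin P.rank)) ∞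
      (fun x => Ring.inverse (L.comp (S x)) (L (v x))) U' :=
    (contMDiffOn_inverse (hLS.mono inter_subset_left) fun x hx => hx.2).clm_apply
      (L.contMDiff.comp_contMDiffOn (hv.mono inter_subset_left))
  set e := trivializationAt (EuclideanSpace ℝ (Fin P.rank)) P.Fiber x₀
  refine (e.contMDiffAt_section_iff (P.mem_chartSet x₀)).2
    ((hc.contMDiffAt (hU'.mem_nhds hx₀')).congr_of_eventuallyEq ?_)
  filter_upwards [hU'.mem_nhds hx₀'] with x hx
  have h6 : S x (e ⟨x, α x⟩).2 = v x := by
    rw [hSsum, show ∑ i, (e ⟨x, α x⟩).2 i • P.frame x₀ i x = α x from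
      P.sum_coef_frame x₀ hx.1.1 (α x)]
    rfl
  have h7 := DFunLike.congr_fun (Ring.inverse_mul_cancel _ hx.2) (e ⟨x, α x⟩).2
  rw [← h6]
  exact h7.symm

/-- The section of `f^!A` with the given components. -/
def PullbackBundle.mkSection (hf : ContMDiff (𝓡 b) (𝓡 m) ∞ f) (σ : ∀ x, A.Fiber (f x))
    (hσ : A.SmoothAlong (b := b) f σ) (X : VField b B)
    (h : ∀ x, A.anchor (f x) (σ x) = mfderiv (𝓡 b) (𝓡 m) f x (X x)) : P.Sections :=
  ⟨fun x => Classical.choose ((P.bijOn x).surjOn (show (σ x, X x) ∈ pullbackFiber f A x from h x)),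
    by
    have hs := fun x => (Classical.choose_spec
      ((P.bijOn x).surjOn (show (σ x, X x) ∈ pullbackFiber f A x from h x))).2
    refine P.contMDiff_section hf ?_ ?_
    · have h1 := fun x => congrArg Prod.fst (hs x)
      dsimp only at h1
      simp only [h1]
      exact hσ
    · have h1 := fun x => congrArg Prod.snd (hs x)
      dsimp only at h1
      simp only [h1]
      exact X.contMDiff⟩

theorem PullbackBundle.proj_mkSection (hf : ContMDiff (𝓡 b) (𝓡 m) ∞ f) (σ : ∀ x, A.Fiber (f x))
    (hσ : A.SmoothAlong (b := b) f σ) (X : VField b B)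
    (h : ∀ x, A.anchor (f x) (σ x) = mfderiv (𝓡 b) (𝓡 m) f x (X x)) (x : B) :
    P.proj x (P.mkSection hf σ hσ X h x) = σ x :=
  congrArg Prod.fst (Classical.choose_spec
    ((P.bijOn x).surjOn (show (σ x, X x) ∈ pullbackFiber f A x from h x))).2

theorem PullbackBundle.anchor_mkSection (hf : ContMDiff (𝓡 b) (𝓡 m) ∞ f) (σ : ∀ x, A.Fiber (f x))
    (hσ : A.SmoothAlong (b := b) f σ) (X : VField b B)
    (h : ∀ x, A.anchor (f x) (σ x) = mfderiv (𝓡 b) (𝓡 m) f x (X x)) (x : B) :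
    P.anchor x (P.mkSection hf σ hσ X h x) = X x :=
  congrArg Prod.snd (Classical.choose_spec
    ((P.bijOn x).surjOn (show (σ x, X x) ∈ pullbackFiber f A x from h x))).2

/-- The second component of a section of `f^!A`. -/
def PullbackBundle.anchorSection (α : P.Sections) : VField b B :=
  ⟨fun x => P.anchor x (α x), P.contMDiff_anchor.comp α.contMDiff⟩

theorem PullbackBundle.anchorSection_apply (α : P.Sections) (x : B) :
    P.anchorSection α x = P.anchor x (α x) := rfl

theorem PullbackBundle.anchor_proj {x : B} (v : P.Fiber x) :
    A.anchor (f x) (P.proj x v) = mfderiv (𝓡 b) (𝓡 m) f x (P.anchor x v) :=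
  (P.bijOn x).mapsTo (mem_univ v)

theorem PullbackBundle.smoothAlong_proj (α : P.Sections) :
    A.SmoothAlong (b := b) f fun x => P.proj x (α x) :=
  P.contMDiff_proj.comp α.contMDiff

/-- The formal combination `ξ` represents the first component of `α` near `x`. -/
def PullbackBundle.Represents (x : B) (ξ : FormalSections b B A) (α : P.Sections) : Prop :=
  ∀ᶠ y in 𝓝 x, formalEval f A y ξ = P.proj y (α y)

theorem PullbackBundle.exists_represents [T2Space B] [T2Space M]
    (hf : ContMDiff (𝓡 b) (𝓡 m) ∞ f) (x : B) (α : P.Sections) : ∃ ξ, P.Represents x ξ α := by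
  obtain ⟨e, -, he⟩ := A.exists_global_frame (f x)
  obtain ⟨h, -, hh⟩ := (P.smoothAlong_proj α).exists_coef hf.continuous x
  refine ⟨∑ i, h i ⊗ₜ e i, ?_⟩
  filter_upwards [hh, hf.continuous.continuousAt.eventually he] with y h1 h2
  simp only [map_sum, formalEval_tmul, h1, h2.2]

variable {P}

theorem PullbackBundle.Represents.add {x : B} {ξ ξ' : FormalSections b B A} {α α' : P.Sections}
    (h : P.Represents x ξ α) (h' : P.Represents x ξ' α') :
    P.Represents x (ξ + ξ') (α + α') := by
  filter_upwards [h, h'] with y h1 h2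
  rw [map_add, h1, h2, ContMDiffSection.coe_add, Pi.add_apply, map_add]

theorem PullbackBundle.Represents.smul {x : B} {ξ : FormalSections b B A} {α : P.Sections}
    (h : P.Represents x ξ α) (c : ℝ) : P.Represents x (c • ξ) (c • α) := by
  filter_upwards [h] with y h1
  rw [map_smul, h1, ContMDiffSection.coe_smul, Pi.smul_apply, map_smul]

theorem PullbackBundle.Represents.smulSection {x : B} {ξ : FormalSections b B A} {α : P.Sections}
    (h : P.Represents x ξ α) (g : C^∞⟮𝓡 b, B; ℝ⟯) :
    P.Represents x (formalSmul A g ξ) (P.smulSection g α) := by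
  filter_upwards [h] with y h1
  rw [formalEval_formalSmul, h1, SmoothVectorBundle.smulSection_apply, map_smul]

/-- The device that transfers identities: second components are compared as vector fields on B,
first components through a common formal representative near each point. -/
theorem PullbackBundle.section_ext {α β : P.Sections} (h : P.anchorSection α = P.anchorSection β)
    (h' : ∀ x, ∃ ξ, P.Represents x ξ α ∧ P.Represents x ξ β) : α = β := by
  ext x
  obtain ⟨ξ, h1, h2⟩ := h' x
  exact P.eq_of_proj_anchor (h1.self_of_nhds.symm.trans h2.self_of_nhds)
    (congrArg (fun X : VField b B => X x) h)

theorem PullbackBundle.Represents.anchor_eventually {x : B} {ξ : FormalSections b B A}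
    {α : P.Sections} (h : P.Represents x ξ α) : ∀ᶠ y in 𝓝 x,
    A.anchor (f y) (formalEval f A y ξ) = mfderiv (𝓡 b) (𝓡 m) f y (P.anchorSection α y) := by
  filter_upwards [h] with y hy
  rw [hy, P.anchor_proj]
  rfl

variable [T2Space B] [T2Space M]

variable (P) in
/-- The first component of the bracket of sections of `f^!A`. -/
def PullbackBundle.bracketProj (hf : ContMDiff (𝓡 b) (𝓡 m) ∞ f) (α β : P.Sections) (x : B) :
    A.Fiber (f x) :=
  formalEval f A x (pairBracket A (P.anchorSection α) (P.anchorSection β)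
    (P.exists_represents hf x α).choose (P.exists_represents hf x β).choose)

/-- The definition chooses new representatives at every point. By independence of the choice, one
pair ξ, η computes the bracket throughout a neighbourhood, which gives its smoothness. -/
theorem PullbackBundle.Represents.bracketProj_eventually (hf : ContMDiff (𝓡 b) (𝓡 m) ∞ f) {x : B}
    {ξ η : FormalSections b B A} {α β : P.Sections} (hα : P.Represents x ξ α)
    (hβ : P.Represents x η β) : ∀ᶠ y in 𝓝 x, P.bracketProj hf α β y =
      formalEval f A y (pairBracket A (P.anchorSection α) (P.anchorSection β) ξ η) := by
  filter_upwards [hα.eventually_nhds, hβ.eventually_nhds] with y h1 h2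
  have h3 : P.Represents y _ α := (P.exists_represents hf y α).choose_spec
  have h4 : P.Represents y _ β := (P.exists_represents hf y β).choose_spec
  refine formalEval_pairBracket_congr hf ?_ ?_ h3.anchor_eventually.self_of_nhds
    h4.anchor_eventually.self_of_nhds
  · filter_upwards [h1, h3] with z h5 h6
    rw [h5, h6]
  · filter_upwards [h2, h4] with z h5 h6
    rw [h5, h6]

variable (P) in
/-- The bracket of sections of `f^!A`. -/
def PullbackBundle.bracketSection (hf : ContMDiff (𝓡 b) (𝓡 m) ∞ f) (α β : P.Sections) :
    P.Sections :=
  P.mkSection hf (P.bracketProj hf α β)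
    (fun x => by
      obtain ⟨ξ, hξ⟩ := P.exists_represents hf x α
      obtain ⟨η, hη⟩ := P.exists_represents hf x β
      refine (smoothAlong_formalEval hf (pairBracket A (P.anchorSection α) (P.anchorSection β) ξ η)
        x).congr_of_eventuallyEq ?_
      filter_upwards [hξ.bracketProj_eventually hf hη] with y hy
      rw [hy])
    (VField.bracket (P.anchorSection α) (P.anchorSection β))
    (fun x => by
      obtain ⟨ξ, hξ⟩ := P.exists_represents hf x α
      obtain ⟨η, hη⟩ := P.exists_represents hf x β
      rw [(hξ.bracketProj_eventually hf hη).self_of_nhds]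
      exact anchor_pairBracket hf hξ.anchor_eventually hη.anchor_eventually)

theorem PullbackBundle.anchorSection_bracketSection (hf : ContMDiff (𝓡 b) (𝓡 m) ∞ f)
    (α β : P.Sections) : P.anchorSection (P.bracketSection hf α β) =
      VField.bracket (P.anchorSection α) (P.anchorSection β) := by
  ext x
  exact P.anchor_mkSection hf _ _ _ _ x

theorem PullbackBundle.Represents.bracket (hf : ContMDiff (𝓡 b) (𝓡 m) ∞ f) {x : B}
    {ξ η : FormalSections b B A} {α β : P.Sections} (hα : P.Represents x ξ α)
    (hβ : P.Represents x η β) :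
    P.Represents x (pairBracket A (P.anchorSection α) (P.anchorSection β) ξ η)
      (P.bracketSection hf α β) := by
  filter_upwards [hα.bracketProj_eventually hf hβ] with y hy
  rw [← hy]
  exact (P.proj_mkSection hf _ _ _ _ y).symm

end Sections

/-! ### The Lie algebroid f^!A -/

section Bracket

variable {b : ℕ} {B : Type uB} [TopologicalSpace B]
  [ChartedSpace (EuclideanSpace ℝ (Fin b)) B] [IsManifold (𝓡 b) ∞ B]
  {m : ℕ} {M : Type uM} [TopologicalSpace M]
  [ChartedSpace (EuclideanSpace ℝ (Fin m)) M] [IsManifold (𝓡 m) ∞ M]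
  {f : B → M} {A : LieAlgebroid.{uM, v} m M}

theorem VField.deriv_add (X X' : VField b B) : (X + X').deriv = X.deriv + X'.deriv := by
  ext g x
  exact dirDeriv_add_right g x (X x) (X' x)

theorem VField.deriv_smul (c : ℝ) (X : VField b B) : (c • X).deriv = c • X.deriv := by
  ext g x
  exact dirDeriv_smul_right g x c (X x)

/-- The product of a function and a vector field. -/
def VField.smulFun (g : C^∞⟮𝓡 b, B; ℝ⟯) (X : VField b B) : VField b B :=
  (tangentAlgebroid b B).smulSection g X

theorem formalDeriv_add_left (X X' : VField b B) :
    formalDeriv A (X + X') = formalDeriv A X + formalDeriv A X' := by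
  rw [formalDeriv, VField.deriv_add, LinearMap.rTensor_add]
  rfl

theorem formalDeriv_smul_left (c : ℝ) (X : VField b B) :
    formalDeriv A (c • X) = c • formalDeriv A X := by
  rw [formalDeriv, VField.deriv_smul, LinearMap.rTensor_smul]
  rfl

theorem formalDeriv_smulFun (g : C^∞⟮𝓡 b, B; ℝ⟯) (X : VField b B) (ξ : FormalSections b B A) :
    formalDeriv A (VField.smulFun g X) ξ = formalSmul A g (formalDeriv A X ξ) := by
  induction ξ using TensorProduct.induction_on with
  | zero => simp
  | add ξ ξ' h h' => simp only [map_add, h, h']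
  | tmul h a =>
    simp only [formalDeriv_tmul, formalSmul_tmul]
    congr 1
    ext x
    exact dirDeriv_smul_right h x (g x) (X x)

variable [T2Space B] [T2Space M] (P : PullbackBundle.{uB, uM, v, w} b f A)

theorem PullbackBundle.anchorSection_add (α α' : P.Sections) :
    P.anchorSection (α + α') = P.anchorSection α + P.anchorSection α' := by
  ext x
  exact map_add (P.anchor x) (α x) (α' x)

theorem PullbackBundle.anchorSection_smul (c : ℝ) (α : P.Sections) :
    P.anchorSection (c • α) = c • P.anchorSection α := by
  ext x
  exact map_smul (P.anchor x) c (α x)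

theorem PullbackBundle.anchorSection_smulSection (g : C^∞⟮𝓡 b, B; ℝ⟯) (α : P.Sections) :
    P.anchorSection (P.smulSection g α) = VField.smulFun g (P.anchorSection α) := by
  ext x
  exact map_smul (P.anchor x) (g x) (α x)

theorem VField.bracket_smulFun (X Y : VField b B) (g : C^∞⟮𝓡 b, B; ℝ⟯) :
    VField.bracket X (VField.smulFun g Y) =
      VField.smulFun (X.deriv g) Y + VField.smulFun g (VField.bracket X Y) :=
  (tangentAlgebroid b B).bracket_smulSection X Y g

/-- The bracket on the sections of `f^!A`. -/
def PullbackBundle.bracket (hf : ContMDiff (𝓡 b) (𝓡 m) ∞ f) :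
    P.Sections →ₗ[ℝ] P.Sections →ₗ[ℝ] P.Sections :=
  LinearMap.mk₂ ℝ (P.bracketSection hf)
    (fun α α' β => by
      refine PullbackBundle.section_ext ?_ fun x => ?_
      · simp only [P.anchorSection_add, PullbackBundle.anchorSection_bracketSection]
        exact LinearMap.map_add₂ (tangentAlgebroid b B).bracket _ _ _
      · obtain ⟨ξ, hξ⟩ := P.exists_represents hf x α
        obtain ⟨ξ', hξ'⟩ := P.exists_represents hf x α'
        obtain ⟨η, hη⟩ := P.exists_represents hf x β
        refine ⟨_, (hξ.add hξ').bracket hf hη, ?_⟩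
        convert (hξ.bracket hf hη).add (hξ'.bracket hf hη) using 1
        simp only [pairBracket, P.anchorSection_add, formalDeriv_add_left, map_add,
          LinearMap.add_apply]
        abel)
    (fun c α β => by
      refine PullbackBundle.section_ext ?_ fun x => ?_
      · simp only [P.anchorSection_smul, PullbackBundle.anchorSection_bracketSection]
        exact LinearMap.map_smul₂ (tangentAlgebroid b B).bracket _ _ _
      · obtain ⟨ξ, hξ⟩ := P.exists_represents hf x α
        obtain ⟨η, hη⟩ := P.exists_represents hf x β
        refine ⟨_, (hξ.smul c).bracket hf hη, ?_⟩
        convert (hξ.bracket hf hη).smul c using 1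
        simp only [pairBracket, P.anchorSection_smul, formalDeriv_smul_left, map_smul,
          LinearMap.smul_apply, smul_add, smul_sub])
    (fun α β β' => by
      refine PullbackBundle.section_ext ?_ fun x => ?_
      · simp only [P.anchorSection_add, PullbackBundle.anchorSection_bracketSection]
        exact map_add ((tangentAlgebroid b B).bracket _) _ _
      · obtain ⟨ξ, hξ⟩ := P.exists_represents hf x α
        obtain ⟨η, hη⟩ := P.exists_represents hf x β
        obtain ⟨η', hη'⟩ := P.exists_represents hf x β'
        refine ⟨_, hξ.bracket hf (hη.add hη'), ?_⟩
        convert (hξ.bracket hf hη).add (hξ.bracket hf hη') using 1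
        simp only [pairBracket, P.anchorSection_add, formalDeriv_add_left, map_add,
          LinearMap.add_apply]
        abel)
    (fun c α β => by
      refine PullbackBundle.section_ext ?_ fun x => ?_
      · simp only [P.anchorSection_smul, PullbackBundle.anchorSection_bracketSection]
        exact map_smul ((tangentAlgebroid b B).bracket _) _ _
      · obtain ⟨ξ, hξ⟩ := P.exists_represents hf x α
        obtain ⟨η, hη⟩ := P.exists_represents hf x β
        refine ⟨_, hξ.bracket hf (hη.smul c), ?_⟩
        convert (hξ.bracket hf hη).smul c using 1
        simp only [pairBracket, P.anchorSection_smul, formalDeriv_smul_left, map_smul,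
          LinearMap.smul_apply, smul_add, smul_sub])

/-- The Lie algebroid `f^!A`. -/
def PullbackBundle.toLieAlgebroid (hf : ContMDiff (𝓡 b) (𝓡 m) ∞ f) :
    LieAlgebroid.{uB, w} b B where
  toSmoothVectorBundle := P.toSmoothVectorBundle
  anchor := P.anchor
  contMDiff_anchor := P.contMDiff_anchor
  bracket := P.bracket hf
  bracket_self α := by
    refine PullbackBundle.section_ext (P := P) ?_ fun x => ?_
    · refine (PullbackBundle.anchorSection_bracketSection hf α α).trans ?_
      refine ((tangentAlgebroid b B).bracket_self _).trans ?_
      ext x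
      exact (map_zero (P.anchor x)).symm
    · obtain ⟨ξ, hξ⟩ := P.exists_represents hf x α
      refine ⟨_, hξ.bracket hf hξ, ?_⟩
      rw [pairBracket_self]
      exact Eventually.of_forall fun y => by
        rw [map_zero, ContMDiffSection.coe_zero, Pi.zero_apply, map_zero]
  jacobi α β γ := by
    refine PullbackBundle.section_ext (P := P) ?_ fun x => ?_
    · change P.anchorSection (P.bracketSection hf α (P.bracketSection hf β γ)) =
        P.anchorSection (P.bracketSection hf (P.bracketSection hf α β) γ +
          P.bracketSection hf β (P.bracketSection hf α γ))
      simp only [P.anchorSection_add, PullbackBundle.anchorSection_bracketSection]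
      exact (tangentAlgebroid b B).jacobi _ _ _
    · obtain ⟨ξ, hξ⟩ := P.exists_represents hf x α
      obtain ⟨η, hη⟩ := P.exists_represents hf x β
      obtain ⟨ζ, hζ⟩ := P.exists_represents hf x γ
      refine ⟨_, hξ.bracket hf (hη.bracket hf hζ), ?_⟩
      have h := ((hξ.bracket hf hη).bracket hf hζ).add (hη.bracket hf (hξ.bracket hf hζ))
      change P.Represents x (pairBracket A (P.anchorSection α)
        (P.anchorSection (P.bracketSection hf β γ)) ξ
        (pairBracket A (P.anchorSection β) (P.anchorSection γ) η ζ))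
        (P.bracketSection hf (P.bracketSection hf α β) γ +
          P.bracketSection hf β (P.bracketSection hf α γ))
      simp only [PullbackBundle.anchorSection_bracketSection] at h ⊢
      rw [pairBracket_jacobi]
      exact h
  leibniz α β g x := by
    -- The pointwise rule is the value at x of an identity of sections, to which
    -- `PullbackBundle.section_ext` applies.
    suffices h : P.bracketSection hf α (P.smulSection g β) =
        P.smulSection ((P.anchorSection α).deriv g) β +
          P.smulSection g (P.bracketSection hf α β) from
      congrArg (fun s : P.Sections => s x) h
    refine PullbackBundle.section_ext ?_ fun x => ?_
    · simp only [P.anchorSection_add, PullbackBundle.anchorSection_bracketSection,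
        P.anchorSection_smulSection, VField.bracket_smulFun]
    · obtain ⟨ξ, hξ⟩ := P.exists_represents hf x α
      obtain ⟨η, hη⟩ := P.exists_represents hf x β
      refine ⟨_, hξ.bracket hf (hη.smulSection g), ?_⟩
      convert (hη.smulSection ((P.anchorSection α).deriv g)).add
        ((hξ.bracket hf hη).smulSection g) using 1
      simp only [pairBracket, P.anchorSection_smulSection, formalDeriv_smulFun,
        formalBracket_formalSmul, formalDeriv_formalSmul, map_add, map_sub]
      abel

/-- The identification of the constructed Lie algebroid with `f^!A`. -/
theorem PullbackBundle.isPullback (hf : ContMDiff (𝓡 b) (𝓡 m) ∞ f) :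
    IsPullback f A (P.toLieAlgebroid hf) := by
  refine ⟨⟨P.proj, P.contMDiff_proj, P.bijOn,
    fun α β => P.anchorSection_bracketSection hf α β, ?_⟩⟩
  intro α β k l h a h' a' hα hβ x
  -- A global presentation is in particular a representative near every point, so it computes the
  -- bracket.
  have h1 : P.Represents x (∑ i, h i ⊗ₜ a i) α := Eventually.of_forall fun y => by
    simp only [map_sum, formalEval_tmul]
    exact (hα y).symm
  have h2 : P.Represents x (∑ j, h' j ⊗ₜ a' j) β := Eventually.of_forall fun y => by
    simp only [map_sum, formalEval_tmul]
    exact (hβ y).symm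
  refine (h1.bracket hf h2).self_of_nhds.symm.trans ?_
  simp only [pairBracket, map_sum, map_add, map_sub, LinearMap.sum_apply, formalBracket_tmul,
    formalDeriv_tmul, formalEval_tmul]
  rw [Finset.sum_comm]
  rfl

end Bracket

/-! ### Supports and cutoff functions -/

section Support

variable {m : ℕ} {M : Type*} [TopologicalSpace M]

theorem secSupport_subset_iUnion {V : M → Type*} [∀ x, AddCommGroup (V x)] [∀ x, Module ℝ (V x)]
    {k : ℕ} {s : ∀ x, V x} {h : Fin k → M → ℝ} {a : Fin k → ∀ x, V x}
    (hs : ∀ x, s x = ∑ i, h i x • a i x) : secSupport s ⊆ ⋃ i, tsupport (h i) := by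
  refine closure_minimal (fun x hx => ?_) (isClosed_iUnion_of_finite fun i => isClosed_tsupport _)
  by_contra hn
  refine hx ((hs x).trans (Finset.sum_eq_zero fun i _ => ?_))
  rw [image_eq_zero_of_notMem_tsupport fun h => hn (mem_iUnion.2 ⟨i, h⟩), zero_smul]

theorem eq_zero_of_notMem_secSupport {V : M → Type*} [∀ x, Zero (V x)] {s : ∀ x, V x} {x : M}
    (hx : x ∉ secSupport s) : s x = 0 := by
  by_contra h
  exact hx (subset_closure h)

theorem isCompact_secSupport_of_subset {V W : M → Type*} [∀ x, Zero (V x)] [∀ x, Zero (W x)]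
    {s : ∀ x, V x} {t : ∀ x, W x} (hs : IsCompact (secSupport s)) (h : ∀ x, s x = 0 → t x = 0) :
    IsCompact (secSupport t) :=
  hs.of_isClosed_subset isClosed_closure (closure_mono fun x hx h0 => hx (h x h0))

variable [ChartedSpace (EuclideanSpace ℝ (Fin m)) M] [T2Space M] [SecondCountableTopology M]
  [IsManifold (𝓡 m) ∞ M]

theorem exists_cutoff {K U : Set M} (hK : IsCompact K) (hU : IsOpen U) (hKU : K ⊆ U) :
    ∃ χ : C^∞⟮𝓡 m, M; ℝ⟯, HasCompactSupport χ ∧ tsupport χ ⊆ U ∧ ∀ y ∈ K, χ y = 1 := by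
  have : LocallyCompactSpace M := ChartedSpace.locallyCompactSpace (EuclideanSpace ℝ (Fin m)) M
  obtain ⟨L, hL, hKL, hLU⟩ := exists_compact_between hK hU hKU
  obtain ⟨χ, h1, h0, -⟩ := exists_contMDiffMap_one_nhds_of_subset_interior (n := (⊤ : ℕ∞)) (𝓡 m)
    hK.isClosed hKL
  have hs : tsupport χ ⊆ L := closure_minimal
    (fun y hy => by_contra fun hn => hy (h0 y hn)) hL.isClosed
  exact ⟨χ, hL.of_isClosed_subset (isClosed_tsupport _) hs, hs.trans hLU,
    fun y hy => h1.self_of_nhdsSet y hy⟩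

end Support

/-! ### The singular foliation of a Lie algebroid -/

section Foliation

variable {m : ℕ} {M : Type uM} [TopologicalSpace M] [T2Space M] [SecondCountableTopology M]
  [ChartedSpace (EuclideanSpace ℝ (Fin m)) M] [IsManifold (𝓡 m) ∞ M]

theorem LieAlgebroid.anchorSection_bracket (A : LieAlgebroid.{uM, v} m M) (a c : A.Sections) :
    A.anchorSection (A.bracket a c) =
      VField.bracket (A.anchorSection a) (A.anchorSection c) := by
  ext1 x
  refine eq_of_dirDeriv_eq fun g => ?_
  have h := (A.deriv_bracket a c g).trans (VField.deriv_bracket _ _ g).symm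
  exact congrArg (fun s : C^∞⟮𝓡 m, M; ℝ⟯ => s x) h

/-- The generators near x are the images of a local frame under the anchor. -/
theorem LieAlgebroid.isLocallyFinitelyGenerated_foliation (A : LieAlgebroid.{uM, v} m M) :
    IsLocallyFinitelyGenerated A.foliation := by
  intro x
  have hU : IsOpen (A.chartSet x) := (trivializationAt _ A.Fiber x).open_baseSet
  refine ⟨A.chartSet x, hU, A.mem_chartSet x, A.rank, fun i y => A.anchor y (A.frame x i y),
    fun i => A.contMDiff_anchor.comp_contMDiffOn (A.contMDiffOn_frame x i), fun X => ⟨?_, ?_⟩⟩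
  · rintro ⟨⟨a, ha, rfl⟩, hX⟩
    have hc : IsCompact (secSupport (A.anchorSection a)) :=
      isCompact_secSupport_of_subset ha fun y hy => by rw [A.anchorSection_apply, hy, map_zero]
    -- Only ρ(a), not a itself, is supported in the frame domain. With χ = 1 on the support of ρ(a),
    -- the section χa is supported there and has the same image.
    obtain ⟨χ, h1, h2, h3⟩ := exists_cutoff (m := m) hc hU hX
    have hco := contMDiffOn_coord_along (trivializationAt _ A.Fiber x)
      (fun y (hy : y ∈ A.chartSet x) => hy) a.contMDiff.contMDiffOn
    have hsm : ∀ i, ContMDiff (𝓡 m) 𝓘(ℝ, ℝ) ∞ fun y => χ y * A.coef x i (a y) := by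
      intro i
      refine contMDiff_of_tsupport fun y hy => ?_
      have hy' : y ∈ A.chartSet x := h2 (tsupport_mul_subset_left hy)
      exact χ.contMDiff.contMDiffAt.mul
        (((EuclideanSpace.proj (𝕜 := ℝ) i).contMDiff.comp_contMDiffOn hco).contMDiffAt (hU.mem_nhds hy'))
    refine ⟨fun i => ⟨_, hsm i⟩, fun i => ⟨h1.mul_right, tsupport_mul_subset_left.trans h2⟩,
      fun y => ?_⟩
    have h4 : ∑ i, (χ y * A.coef x i (a y)) • A.anchor y (A.frame x i y) =
        χ y • A.anchor y (∑ i, A.coef x i (a y) • A.frame x i y) := by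
      simp only [map_sum, Finset.smul_sum, mul_smul, map_smul]
    refine Eq.trans ?_ h4.symm
    by_cases hy : y ∈ secSupport (A.anchorSection a)
    · rw [h3 y hy, one_smul, A.sum_coef_frame x (hX hy)]
      rfl
    · rw [eq_zero_of_notMem_secSupport hy]
      by_cases hy' : y ∈ A.chartSet x
      · rw [A.sum_coef_frame x hy', ← A.anchorSection_apply, eq_zero_of_notMem_secSupport hy,
          smul_zero]
      · rw [image_eq_zero_of_notMem_tsupport fun h => hy' (h2 h), zero_smul]
  · rintro ⟨h, hh, hX⟩
    refine ⟨⟨∑ i, A.cutoff (h i) hU (hh i).2 (A.frame x i) (A.contMDiffOn_frame x i), ?_, ?_⟩,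
      (secSupport_subset_iUnion hX).trans (iUnion_subset fun i => (hh i).2)⟩
    · exact (isCompact_iUnion fun i => (hh i).1).of_isClosed_subset isClosed_closure
        (secSupport_subset_iUnion fun y => A.sum_apply _ _ y)
    · ext1 y
      rw [hX, A.anchorSection_apply, A.sum_apply, map_sum]
      exact Finset.sum_congr rfl fun i _ => (map_smul (A.anchor y) (h i y) (A.frame x i y)).symm

/-- The vector fields `ρ(Γ_c(A))` of a Lie algebroid form a singular foliation. -/
theorem LieAlgebroid.isSingularFoliation_foliation (A : LieAlgebroid.{uM, v} m M) :
    IsSingularFoliation A.foliation where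
  isCompact_support := by
    rintro _ ⟨a, ha, rfl⟩
    exact isCompact_secSupport_of_subset ha fun y hy => by
      rw [A.anchorSection_apply, hy, map_zero]
  zero_mem := by
    refine ⟨0, ?_, ?_⟩
    · have : secSupport (0 : A.Sections) = ∅ := by
        simp [secSupport]
      rw [this]
      exact isCompact_empty
    · ext1 y
      exact (map_zero (A.anchor y)).symm
  add_mem := by
    rintro _ ⟨a, ha, rfl⟩ _ ⟨c, hc, rfl⟩
    refine ⟨a + c, (ha.union hc).of_isClosed_subset isClosed_closure
      (closure_minimal (fun y hy => ?_) (isClosed_closure.union isClosed_closure)), ?_⟩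
    · by_contra hn
      rw [mem_union, not_or] at hn
      refine hy ?_
      rw [ContMDiffSection.coe_add, Pi.add_apply, eq_zero_of_notMem_secSupport hn.1,
        eq_zero_of_notMem_secSupport hn.2, add_zero]
    · ext1 y
      exact (map_add (A.anchor y) (a y) (c y)).symm
  smul_mem := by
    rintro g _ ⟨a, ha, rfl⟩ Z hZ
    refine ⟨A.smulSection g a, isCompact_secSupport_of_subset ha fun y hy => by
      rw [A.smulSection_apply, hy, smul_zero], ?_⟩
    ext1 y
    exact (hZ y).trans (map_smul (A.anchor y) (g y) (a y)).symm
  locallyFinitelyGenerated := A.isLocallyFinitelyGenerated_foliation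
  involutive := by
    rintro _ ⟨a, -, rfl⟩ _ ⟨c, hc, rfl⟩
    -- By locality [a, c] vanishes off the support of c, so compactness of that support suffices.
    refine ⟨A.bracket a c, hc.of_isClosed_subset isClosed_closure
      (closure_minimal (fun y hy => ?_) isClosed_closure), (A.anchorSection_bracket a c).symm⟩
    by_contra hn
    refine hy (A.bracket_eq_zero_of_eventually a ?_)
    filter_upwards [(isClosed_closure.isOpen_compl).mem_nhds hn] with z hz
    exact eq_zero_of_notMem_secSupport hz

end Foliation

/-! ### The foliation of f^!A is the pullback foliation -/

section Pullback

variable {b : ℕ} {B : Type uB} [TopologicalSpace B] [T2Space B] [SecondCountableTopology B]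
  [ChartedSpace (EuclideanSpace ℝ (Fin b)) B] [IsManifold (𝓡 b) ∞ B]
  {m : ℕ} {M : Type uM} [TopologicalSpace M] [T2Space M]
  [ChartedSpace (EuclideanSpace ℝ (Fin m)) M] [IsManifold (𝓡 m) ∞ M]
  {f : B → M}

/-- A compactly supported section along `f` is a finite combination of sections of `A`. -/
theorem SmoothVectorBundle.SmoothAlong.exists_eq_sum {A : SmoothVectorBundle.{uM, v} m M}
    (hf : Continuous f) {σ : ∀ x, A.Fiber (f x)} (hσ : A.SmoothAlong (b := b) f σ)
    (hc : IsCompact (secSupport σ)) :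
    ∃ (k : ℕ) (h : Fin k → C^∞⟮𝓡 b, B; ℝ⟯) (a : Fin k → A.Sections),
      (∀ i, HasCompactSupport (h i)) ∧ (∀ i, IsCompact (secSupport (a i))) ∧
      ∀ x, σ x = ∑ i, h i x • a i (f x) := by
  have : LocallyCompactSpace B := ChartedSpace.locallyCompactSpace (EuclideanSpace ℝ (Fin b)) B
  have hloc : ∀ x₀ : B, ∃ (U : Set B) (h : Fin A.rank → C^∞⟮𝓡 b, B; ℝ⟯)
      (a : Fin A.rank → A.Sections), IsOpen U ∧ x₀ ∈ U ∧ (∀ i, HasCompactSupport (h i)) ∧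
      (∀ i, IsCompact (secSupport (a i))) ∧ ∀ x ∈ U, σ x = ∑ i, h i x • a i (f x) := by
    intro x₀
    obtain ⟨e, he, he'⟩ := A.exists_global_frame (f x₀)
    obtain ⟨h, hh, hh'⟩ := hσ.exists_coef hf x₀
    obtain ⟨U, hU, hUo, hx⟩ :=
      eventually_nhds_iff.1 (hh'.and (hf.continuousAt.eventually he'))
    refine ⟨U, h, e, hUo, hx, hh, he, fun x hxU => ?_⟩
    rw [(hU x hxU).1]
    simp only [(hU x hxU).2.2]
  choose U h a hUo hxU hh ha hsum using hloc
  -- Each ρ_i σ is a combination on all of B, since the local expansion is valid where ρ_i ≠ 0. Only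
  -- finitely many ρ_i meet the compact support of σ, and off it the sum vanishes with σ.
  obtain ⟨ρ, hρ⟩ := SmoothPartitionOfUnity.exists_isSubordinate (𝓡 b) hc.isClosed U hUo
    fun x _ => mem_iUnion.2 ⟨x, hxU x⟩
  have hfin := ρ.locallyFinite.finite_nonempty_inter_compact hc
  set I : Finset B := hfin.toFinset
  have hterm : ∀ i x, ρ i x • σ x = ∑ j, (ρ i x * h i j x) • a i j (f x) := by
    intro i x
    by_cases hx : x ∈ U i
    · rw [hsum i x hx, Finset.smul_sum]
      simp only [mul_smul]
    · have h0 : ρ i x = 0 := image_eq_zero_of_notMem_tsupport fun h => hx (hρ i h)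
      simp [h0]
  have hσ' : ∀ x, σ x = ∑ p : I × Fin A.rank,
      (ρ p.1 x * h p.1 p.2 x) • a p.1 p.2 (f x) := by
    intro x
    rw [Fintype.sum_prod_type]
    simp only [← hterm]
    rw [← Finset.sum_smul]
    by_cases hx : x ∈ secSupport σ
    · have h1 : ∑ i ∈ I, ρ i x = 1 := ρ.sum_finsupport' x hx fun i hi =>
        hfin.mem_toFinset.2 ⟨x, (ρ.mem_finsupport x).1 hi, hx⟩
      rw [Finset.sum_coe_sort I fun i => ρ i x, h1, one_smul]
    · rw [eq_zero_of_notMem_secSupport hx, smul_zero]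
  let e := Fintype.equivFin (I × Fin A.rank)
  refine ⟨_, fun i => ρ (e.symm i).1 * h (e.symm i).1 (e.symm i).2,
    fun i => a (e.symm i).1 (e.symm i).2, fun i => (hh _ _).mul_left, fun i => ha _ _, fun x => ?_⟩
  rw [hσ' x, ← e.symm.sum_comp]
  rfl

variable {A : LieAlgebroid.{uM, v} m M}

/-- The vector bundle underlying a pullback Lie algebroid. -/
def PullbackIdentification.toPullbackBundle {P : LieAlgebroid.{uB, w} b B}
    (I : PullbackIdentification f A P) : PullbackBundle.{uB, uM, v, w} b f A where
  toSmoothVectorBundle := P.toSmoothVectorBundle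
  proj := I.proj
  contMDiff_proj := I.contMDiff_proj
  anchor := P.anchor
  contMDiff_anchor := P.contMDiff_anchor
  bijOn := I.bijOn

/-- The compactly supported sections of `f^!A` induce the pullback of the foliation of `A`. -/
theorem PullbackBundle.exists_anchorSection_eq_iff (P : PullbackBundle.{uB, uM, v, w} b f A)
    (hf : ContMDiff (𝓡 b) (𝓡 m) ∞ f) (X : VField b B) :
    (∃ α : P.Sections, IsCompact (secSupport α) ∧ X = P.anchorSection α) ↔
      X ∈ pullbackFoliation f A.foliation := by
  constructor
  · rintro ⟨α, hα, rfl⟩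
    refine ⟨isCompact_secSupport_of_subset hα fun x hx => by
      rw [P.anchorSection_apply, hx, map_zero], ?_⟩
    obtain ⟨k, h, a, hh, ha, hs⟩ := (P.smoothAlong_proj α).exists_eq_sum hf.continuous
      (isCompact_secSupport_of_subset hα fun x hx => by rw [hx, map_zero])
    refine ⟨k, h, fun i => A.anchorSection (a i), hh, fun i => ⟨a i, ha i, rfl⟩, fun x => ?_⟩
    refine (P.anchor_proj (α x)).symm.trans ?_
    rw [hs x, map_sum]
    exact Finset.sum_congr rfl fun i _ => map_smul _ _ _
  · rintro ⟨hX, k, h, Y, hh, hY, hs⟩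
    choose a ha hYa using hY
    have hev : ∀ x, formalEval f A x (∑ i, h i ⊗ₜ a i) = ∑ i, h i x • a i (f x) := fun x => by
      simp only [map_sum, formalEval_tmul]
    have hanchor : ∀ x, A.anchor (f x) (formalEval f A x (∑ i, h i ⊗ₜ a i)) =
        mfderiv (𝓡 b) (𝓡 m) f x (X x) := by
      intro x
      rw [hev, map_sum, hs]
      refine Finset.sum_congr rfl fun i _ => ?_
      rw [map_smul, hYa i]
      rfl
    -- The assumption on f_*X is exactly the fibre product condition for (∑ h_i a_i ∘ f, X). Its
    -- support lies in the union of those of X and the h_i, as the two projections are jointly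
    -- injective.
    set α := P.mkSection hf _ (smoothAlong_formalEval hf (∑ i, h i ⊗ₜ a i)) X hanchor
    refine ⟨α, ?_, ?_⟩
    · have hc : IsCompact (secSupport X ∪ ⋃ i, tsupport (h i)) :=
        hX.union (isCompact_iUnion hh)
      refine hc.of_isClosed_subset isClosed_closure
        (closure_minimal (fun x hx => ?_) hc.isClosed)
      by_contra hn
      rw [mem_union, not_or] at hn
      refine hx (P.eq_of_proj_anchor ?_ ?_)
      · rw [P.proj_mkSection, map_zero, hev]
        refine Finset.sum_eq_zero fun i _ => ?_
        rw [image_eq_zero_of_notMem_tsupport fun h => hn.2 (mem_iUnion.2 ⟨i, h⟩), zero_smul]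
      · rw [P.anchor_mkSection, map_zero, eq_zero_of_notMem_secSupport hn.1]
    · ext1 x
      exact (P.anchor_mkSection hf _ _ X hanchor x).symm

/-- The foliation of the pullback Lie algebroid is the pullback foliation. -/
theorem IsPullback.foliation_eq {P : LieAlgebroid.{uB, w} b B} (hP : IsPullback f A P)
    (hf : ContMDiff (𝓡 b) (𝓡 m) ∞ f) : P.foliation = pullbackFoliation f A.foliation := by
  obtain ⟨I⟩ := hP
  ext X
  -- Only the bundle and its two projections enter; the bracket of P is forgotten.
  exact I.toPullbackBundle.exists_anchorSection_eq_iff hf X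

end Pullback

end LieAlg

end

theorem proposition3p1 {b m : ℕ}
    {B : Type uB} [TopologicalSpace B] [T2Space B] [SecondCountableTopology B]
    [ChartedSpace (EuclideanSpace ℝ (Fin b)) B] [IsManifold (𝓡 b) ∞ B]
    {M : Type uM} [TopologicalSpace M] [T2Space M] [SecondCountableTopology M]
    [ChartedSpace (EuclideanSpace ℝ (Fin m)) M] [IsManifold (𝓡 m) ∞ M]
    (f : B → M) (hf : ContMDiff (𝓡 b) (𝓡 m) ∞ f)
    (A : LieAlg.LieAlgebroid.{uM, v} m M) (hA : LieAlg.PullbackIsSmooth (b := b) f A) :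
    (∃ P : LieAlg.LieAlgebroid.{uB, v} b B, LieAlg.IsPullback f A P) ∧
    (∀ P : LieAlg.LieAlgebroid.{uB, w} b B, LieAlg.IsPullback f A P →
      P.foliation = LieAlg.pullbackFoliation f A.foliation) ∧
    LieAlg.IsSingularFoliation (m := b) (LieAlg.pullbackFoliation f A.foliation) := by
  obtain ⟨Q⟩ := LieAlg.exists_pullbackBundle hf hA
  have hQ := Q.isPullback hf
  refine ⟨⟨_, hQ⟩, fun P hP => hP.foliation_eq hf, ?_⟩
  -- The last claim does not mention P, so the constructed algebroid can be used.
  rw [← hQ.foliation_eq hf]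
  exact LieAlg.LieAlgebroid.isSingularFoliation_foliation _
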